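/- Let $p,q,r\in(1,\infty)$ satisfy $\frac1p+\frac1q=1+\frac1r$, let $s'=\frac{s}{s-1}$ denote the conjugate exponent of $s$, and put $c_1=\frac1p$, $c_2=\frac1q$, $c_3=1-\frac1r$. Let $$K=\Bigl(\frac{p^{1/p}\,q^{1/q}\,{r'}^{1/r'}}{{p'}^{1/p'}\,{q'}^{1/q'}\,r^{1/r}}\Bigr)^{1/2}.$$ (1) For all (real- or complex-valued) $F\in L_p(\mathbb R)$ and $G\in L_q(\mathbb R)$, the convolution $F*G$ is defined almost everywhere and belongs to $L_r(\mathbb R)$. The smallest real number $C$ such that $\|F*G\|_r\le C\,\|F\|_p\,\|G\|_q$ for all such $F,G$ is $C=K$ (Beckner's constant), and $K<1$. (2) $K$ is also the smallest real number $C$ such that $$\int_{\mathbb R^2} f(x+y)^{c_1}\,g(y)^{c_2}\,h(x)^{c_3}\,dx\,dy\le C\Bigl(\int_{\mathbb R} f\Bigr)^{c_1}\Bigl(\int_{\mathbb R} g\Bigr)^{c_2}\Bigl(\int_{\mathbb R} h\Bigr)^{c_3}$$ for all non-negative integrable $f,g,h\colon\mathbb R\to\mathbb R$. In other words, $K$ is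 the Brascamp-Lieb constant of the datum $(c_1,B_1),(c_2,B_2),(c_3,B_3)$ on $\mathbb R^2$ with $B_1=(1,1)$, $B_2=(0,1)$, $B_3=(1,0)$, that is, the smallest real $C$ such that $\int_{\mathbb R^2}\prod_i (f_i\circ B_i)^{c_i}\,dx\le C\prod_i\bigl(\int_{\mathbb R} f_i\bigr)^{c_i}$ for all non-negative integrable $f_1,f_2,f_3$. (3) Consider the condition $$A^{-1}=\sum_{i=1}^3 c_i\,B_i^*\,(B_iAB_i^*)^{-1}B_i \qquad (*)$$ on a matrix $A$. For arbitrary weights $c_1,c_2,c_3>0$ and positive definite $A=\begin{pmatrix}x&z\\z&y\end{pmatrix}$, $(*)$ is equivalent to the system $$(1-c_2)xy+yz+c_2z^2=0,\qquad (1-c_3)xy+xz+c_3z^2=0,\qquad c_1+c_2+c_3=2 .$$ For the weights $c_1=\frac1p$, $c_2=\frac1q$, $c_3=1-\frac1r$, a triple $(x,y,z)\in\mathbb R^3$ with $z\neq0$ solves the first two equations if and only if it is a multiple of $(1,1,-1)$ or a multiple of $\bigl(c_3(1-c_3),\,c_2(1-c_2),\,-(1-c_2)(1-c_3)\bigr)$;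 and $A$ is positive definite and satisfies $(*)$ if and only if $A=t\begin{pmatrix}c_3(1-c_3)&-(1-c_2)(1-c_3)\\-(1-c_2)(1-c_3)&c_2(1-c_2)\end{pmatrix}$ for some $t>0$. (4) For every positive definite $A$ satisfying $(*)$ with these weights, $$K=\Bigl(\frac{\det(A)}{\prod_{i=1}^3\det(B_iAB_i^*)^{c_i}}\Bigr)^{1/2}=\Bigl(\frac{(1-c_1)^{1-c_1}(1-c_2)^{1-c_2}(1-c_3)^{1-c_3}}{c_1^{c_1}c_2^{c_2}c_3^{c_3}}\Bigr)^{1/2}.$$ -/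

import Mathlib

open MeasureTheory
open scoped Matrix

noncomputable section

/-- A Brascamp-Lieb datum on `ℝⁿ`: finitely many pairs `(cᵢ, Bᵢ)` where `cᵢ > 0` and
`Bᵢ : ℝⁿ → ℝ^{nᵢ}` is linear (given by its matrix) and onto. -/
structure BrascampLiebDatum (n m : ℕ) where
  dim : Fin m → ℕ
  c : Fin m → ℝ
  B : ∀ i, Matrix (Fin (dim i)) (Fin n) ℝ
  c_pos : ∀ i, 0 < c i
  onto : ∀ i, Function.Surjective (B i).mulVec

namespace BrascampLiebDatum

variable {n m : ℕ}

/-- The Brascamp-Lieb inequality with constant `C`, for all non-negative integrable functions.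
The left-hand side is a `lintegral`, so that its finiteness is part of the inequality. -/
def Inequality (D : BrascampLiebDatum n m) (C : ℝ) : Prop :=
  ∀ f : ∀ i, (Fin (D.dim i) → ℝ) → ℝ, (∀ i x, 0 ≤ f i x) → (∀ i, Integrable (f i) volume) →
    ∫⁻ x : Fin n → ℝ, ENNReal.ofReal (∏ i, (f i (D.B i *ᵥ x)) ^ D.c i) ≤
      ENNReal.ofReal (C * ∏ i, (∫ y, f i y) ^ D.c i)

/-- `C` is the Brascamp-Lieb constant: the smallest real number for which the inequality holds. -/
def IsConstant (D : BrascampLiebDatum n m) (C : ℝ) : Prop :=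
  IsLeast {C : ℝ | D.Inequality C} C

/-- The condition `A⁻¹ = ∑ᵢ cᵢ Bᵢ* (Bᵢ A Bᵢ*)⁻¹ Bᵢ`. -/
def MatrixCondition (D : BrascampLiebDatum n m) (A : Matrix (Fin n) (Fin n) ℝ) : Prop :=
  A⁻¹ = ∑ i, D.c i • ((D.B i)ᵀ * (D.B i * A * (D.B i)ᵀ)⁻¹ * D.B i)

/-- The number `(det A / ∏ᵢ det (Bᵢ A Bᵢ*)^{cᵢ})^{1/2}`. -/
def gaussianValue (D : BrascampLiebDatum n m) (A : Matrix (Fin n) (Fin n) ℝ) : ℝ :=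
  √(A.det / ∏ i, (D.B i * A * (D.B i)ᵀ).det ^ D.c i)

end BrascampLiebDatum

/-- The three linear forms `(1,1)`, `(0,1)`, `(1,0)` on `ℝ²`. -/
def youngMap : Fin 3 → Matrix (Fin 1) (Fin 2) ℝ :=
  ![!![1, 1], !![0, 1], !![1, 0]]

theorem youngMap_onto (i : Fin 3) : Function.Surjective (youngMap i).mulVec := by
  intro y
  fin_cases i
  · refine ⟨![y 0, 0], ?_⟩
    ext j; fin_cases j; simp [youngMap]
  · refine ⟨![0, y 0], ?_⟩
    ext j; fin_cases j; simp [youngMap]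
  · refine ⟨![y 0, 0], ?_⟩
    ext j; fin_cases j; simp [youngMap]

/-- The datum `(c₁, (1,1)), (c₂, (0,1)), (c₃, (1,0))` on `ℝ²`. -/
def youngDatum (c : Fin 3 → ℝ) (hc : ∀ i, 0 < c i) : BrascampLiebDatum 2 3 where
  dim := fun _ => 1
  c := c
  B := youngMap
  c_pos := hc
  onto := youngMap_onto

/-- The weights `c₁ = 1/p`, `c₂ = 1/q`, `c₃ = 1 - 1/r`. -/
def youngWeight (p q r : ℝ) : Fin 3 → ℝ :=
  ![1 / p, 1 / q, 1 - 1 / r]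

theorem youngWeight_pos {p q r : ℝ} (hp : 1 < p) (hq : 1 < q) (hr : 1 < r) (i : Fin 3) :
    0 < youngWeight p q r i := by
  have hr' : 1 / r < 1 := by rw [div_lt_one (by linarith)]; exact hr
  fin_cases i
  · simp only [youngWeight]; simp; linarith
  · simp only [youngWeight]; simp; linarith
  · simp only [youngWeight]; simpa using hr'

/-- Beckner's constant
`(p^{1/p} q^{1/q} r'^{1/r'} / (p'^{1/p'} q'^{1/q'} r^{1/r}))^{1/2}`, where
`s' = s / (s - 1)` is the conjugate exponent of `s`. -/
def becknerConstant (p q r : ℝ) : ℝ :=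
  √((p ^ (1 / p) * q ^ (1 / q) * r.conjExponent ^ (1 / r.conjExponent)) /
    (p.conjExponent ^ (1 / p.conjExponent) * q.conjExponent ^ (1 / q.conjExponent) *
      r ^ (1 / r)))

/-- The convolution `(F * G)(x) = ∫ F(t) G(x - t) dt` on the real line. -/
def lineConvolution {𝕜 : Type*} [RCLike 𝕜] (F G : ℝ → 𝕜) : ℝ → 𝕜 :=
  convolution F G (ContinuousLinearMap.mul 𝕜 𝕜) volume

/-- `‖F * G‖_r ≤ C ‖F‖_p ‖G‖_q` for all `F ∈ L_p(ℝ)` and `G ∈ L_q(ℝ)`. -/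
def YoungInequality (𝕜 : Type*) [RCLike 𝕜] (p q r C : ℝ) : Prop :=
  ∀ F G : ℝ → 𝕜, MemLp F (ENNReal.ofReal p) volume → MemLp G (ENNReal.ofReal q) volume →
    eLpNorm (lineConvolution F G) (ENNReal.ofReal r) volume ≤
      ENNReal.ofReal C * eLpNorm F (ENNReal.ofReal p) volume *
        eLpNorm G (ENNReal.ofReal q) volume

/-- The inequality
`∫_{ℝ²} f(x+y)^{c₁} g(y)^{c₂} h(x)^{c₃} dx dy ≤ C (∫ f)^{c₁} (∫ g)^{c₂} (∫ h)^{c₃}` for all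
non-negative integrable `f, g, h`. -/
def TrilinearInequality (c₁ c₂ c₃ C : ℝ) : Prop :=
  ∀ f g h : ℝ → ℝ, (∀ x, 0 ≤ f x) → (∀ x, 0 ≤ g x) → (∀ x, 0 ≤ h x) →
    Integrable f volume → Integrable g volume → Integrable h volume →
    ∫⁻ z : ℝ × ℝ, ENNReal.ofReal (f (z.1 + z.2) ^ c₁ * g z.2 ^ c₂ * h z.1 ^ c₃) ≤
      ENNReal.ofReal (C * ((∫ x, f x) ^ c₁ * (∫ x, g x) ^ c₂ * (∫ x, h x) ^ c₃))

end

/-! Put a_i = 1 - c_i, so that a_1 + a_2 + a_3 = 1. The trilinear inequality is proved by Barthe's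
transport argument. Each function, normalised to integral 1, is written f_i = e^{-πT_i²} T_i' with
T_i increasing. The planar map S(z) = Σ k_i B_i^* T_i(B_i z) is injective, and its Jacobian is the
sum of the pairwise products of the k_i T_i'. Weighted AM-GM bounds ∏ (T_i')^{c_i} by a multiple of
this Jacobian, and Σ c_i t_i² dominates a positive definite quadratic form Q in v = Σ k_i t_i B_i^*.
Changing variables bounds the left-hand side by a multiple of ∫ e^{-πQ}, which is K. With {i,j,l} =
{1,2,3}, the choice k_i = √(c_i a_j a_l) makes both estimates equalities for the Gaussians e^{-πb_i
x²}, b_i = a_j a_l / c_i, up to normalisation. Testing on them shows that K is optimal.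

Young's inequality is dual to this: for f = |F|^p and g(x) = |G(-x)|^q, the trilinear form pairs |F|
* |G| with h^{1-1/r}. Duality in L_r gives one direction with the same constant, Hölder the other.

The matrix condition is algebra. Eliminating xy from the two homogeneous equations leaves two lines
of solutions with z ≠ 0; one is singular and the other gives the positive definite solutions. Since
Σ c_i = 2 is the dimension, the Gaussian value does not depend on the scale of A. -/

/-! ### Monotone transport to the Gaussian density -/

open Set Filter Topology in
/-- The inverse of `x ↦ ∫ t in 0..x, exp (-π t²)`, with its derivative. -/
theorem exists_gaussian_quantile :
    ∃ Q : ℝ → ℝ, StrictMonoOn Q (Ioo (-(1 / 2)) (1 / 2)) ∧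
      ∀ v ∈ Ioo (-(1 / 2) : ℝ) (1 / 2), HasDerivAt Q (Real.exp (-Real.pi * Q v ^ 2))⁻¹ v := by
  set γ : ℝ → ℝ := fun t => Real.exp (-Real.pi * t ^ 2) with hγ
  have hγc : Continuous γ := by fun_prop
  have hγpos : ∀ t, 0 < γ t := fun t => Real.exp_pos _
  have hγi : Integrable γ := integrable_exp_neg_mul_sq Real.pi_pos
  set G : ℝ → ℝ := fun x => ∫ t in (0 : ℝ)..x, γ t with hG
  have hGd : ∀ x, HasStrictDerivAt G (γ x) x := fun x =>
    intervalIntegral.integral_hasStrictDerivAt_right (hγc.intervalIntegrable _ _)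
      (hγc.stronglyMeasurableAtFilter _ _) hγc.continuousAt
  have hGm : StrictMono G := strictMono_of_deriv_pos fun x => by
    rw [(hGd x).hasDerivAt.deriv]; exact hγpos x
  have hGc : Continuous G := continuous_iff_continuousAt.2 fun x => (hGd x).hasDerivAt.continuousAt
  have hhalf : ∫ t in Ioi (0 : ℝ), γ t = 1 / 2 := by
    rw [hγ, integral_gaussian_Ioi, div_self Real.pi_ne_zero, Real.sqrt_one]
  have htop : Tendsto G atTop (𝓝 (1 / 2)) := by
    rw [← hhalf]
    exact intervalIntegral_tendsto_integral_Ioi 0 hγi.integrableOn tendsto_id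
  have hodd : ∀ x, G (-x) = -G x := by
    intro x
    have := intervalIntegral.integral_comp_neg (a := 0) (b := x) γ
    rw [neg_zero] at this
    have h2 : (fun t => γ (-t)) = γ := by ext t; simp [hγ]
    rw [h2] at this
    simp only [hG]
    rw [intervalIntegral.integral_symm, this]
  have hsurj : ∀ v ∈ Ioo (-(1 / 2) : ℝ) (1 / 2), ∃ x, G x = v := by
    rintro v ⟨hv1, hv2⟩
    obtain ⟨b, hb⟩ := (htop.eventually (lt_mem_nhds hv2)).exists
    obtain ⟨a, ha⟩ := (htop.eventually (lt_mem_nhds (by linarith : -v < 1 / 2))).exists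
    have ha' : G (-a) < v := by rw [hodd]; linarith
    obtain ⟨x, hx⟩ := mem_range_of_exists_le_of_exists_ge hGc ⟨-a, ha'.le⟩ ⟨b, hb.le⟩
    exact ⟨x, hx⟩
  refine ⟨Function.invFun G, ?_, ?_⟩
  · intro u hu v hv huv
    rw [← hGm.lt_iff_lt, Function.invFun_eq (hsurj u hu), Function.invFun_eq (hsurj v hv)]
    exact huv
  · intro v hv
    obtain ⟨x, rfl⟩ := hsurj v hv
    have hl := Function.leftInverse_invFun hGm.injective
    rw [hl x]
    -- Injectivity of G identifies the global inverse with the local inverse of the inverse function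
    -- theorem near G x.
    have h1 := (hGd x).to_localInverse (hγpos x).ne'
    refine h1.hasDerivAt.congr_of_eventuallyEq ?_
    have h2 := ((hGd x).hasStrictFDerivAt_equiv (hγpos x).ne').eventually_right_inverse
    filter_upwards [h2] with y hy
    conv_lhs => rw [← hy]
    rw [hl]

open Set Filter Topology in
/-- Transport of a probability density to the Gaussian density `exp (-π t²)`: on a set `s` of full
measure for `f`, an increasing differentiable function `T` satisfies `f = exp (-π T²) T'`. -/
theorem exists_gaussian_transport {f : ℝ → ℝ} (hf0 : ∀ x, 0 ≤ f x) (hfm : Measurable f)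
    (hfi : Integrable f) (hf1 : ∫ x, f x = 1) :
    ∃ (s : Set ℝ) (T T' : ℝ → ℝ), MeasurableSet s ∧ (∀ᵐ x, 0 < f x → x ∈ s) ∧
      StrictMonoOn T s ∧
      ∀ x ∈ s, 0 < T' x ∧ HasDerivAt T (T' x) x ∧ f x = Real.exp (-Real.pi * T x ^ 2) * T' x := by
  obtain ⟨Q, hQm, hQd⟩ := exists_gaussian_quantile
  set F : ℝ → ℝ := fun x => (∫ t in Iic x, f t) - 1 / 2 with hF
  have hFmono : Monotone F := by
    intro x y hxy
    have := setIntegral_mono_set (hfi.integrableOn (s := Iic y)) (ae_of_all _ hf0)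
      (Iic_subset_Iic.2 hxy).eventuallyLE
    simp only [hF]; linarith
  have hF1 : ∀ x, F x ≤ 1 / 2 := by
    intro x
    have := setIntegral_le_integral (s := Iic x) hfi (ae_of_all _ hf0)
    simp only [hF]; linarith
  have hF0 : ∀ x, -(1 / 2) ≤ F x := by
    intro x
    have := setIntegral_nonneg (s := Iic x) (μ := volume) measurableSet_Iic (fun t _ => hf0 t)
    simp only [hF]; linarith
  have hFd : ∀ᵐ x, HasDerivAt F (f x) x := by
    filter_upwards [LocallyIntegrable.ae_hasDerivAt_integral hfi.locallyIntegrable] with x hx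
    have h : F = fun x => (∫ t in (0 : ℝ)..x, f t) + ((∫ t in Iic (0 : ℝ), f t) - 1 / 2) := by
      ext y
      rw [← intervalIntegral.integral_Iic_sub_Iic hfi.integrableOn hfi.integrableOn]
      simp only [hF]; ring
    rw [h]
    exact (hx 0).add_const _
  -- The exceptional null set is enlarged to a measurable one, because s must be measurable for the
  -- change of variables.
  obtain ⟨N, hN, hNm, hN0⟩ := exists_measurable_superset_of_null (ae_iff.1 hFd)
  have hd : ∀ x ∉ N, HasDerivAt F (f x) x := fun x hx => by
    by_contra h; exact hx (hN h)
  -- A monotone F with positive derivative at x cannot be constant on an interval ending at x. Hence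
  -- strictness holds against every y, even where f vanishes.
  have key : ∀ x, 0 < f x → HasDerivAt F (f x) x → ∀ y, (x < y → F x < F y) ∧ (y < x → F y < F x) := by
    intro x hx hdx y
    constructor
    · intro hxy
      refine (hFmono hxy.le).lt_of_ne fun h => ?_
      have hc : ∀ z ∈ Icc x y, F z = F x := fun z hz =>
        le_antisymm ((hFmono hz.2).trans h.ge) (hFmono hz.1)
      have h1 : HasDerivWithinAt F (f x) (Icc x y) x := hdx.hasDerivWithinAt
      have h2 : HasDerivWithinAt F 0 (Icc x y) x :=
        (hasDerivWithinAt_const x _ (F x)).congr (fun z hz => hc z hz) rfl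
      exact hx.ne' ((uniqueDiffOn_Icc hxy x ⟨le_rfl, hxy.le⟩).eq_deriv _ h1 h2)
    · intro hxy
      refine (hFmono hxy.le).lt_of_ne fun h => ?_
      have hc : ∀ z ∈ Icc y x, F z = F x := fun z hz =>
        le_antisymm (hFmono hz.2) (h.ge.trans (hFmono hz.1))
      have h1 : HasDerivWithinAt F (f x) (Icc y x) x := hdx.hasDerivWithinAt
      have h2 : HasDerivWithinAt F 0 (Icc y x) x :=
        (hasDerivWithinAt_const x _ (F x)).congr (fun z hz => hc z hz) rfl
      exact hx.ne' ((uniqueDiffOn_Icc hxy x ⟨hxy.le, le_rfl⟩).eq_deriv _ h1 h2)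
  -- Strictness on both sides keeps F x away from ±1/2, where nothing is known about Q.
  have hFI : ∀ x, 0 < f x → x ∉ N → F x ∈ Ioo (-(1 / 2) : ℝ) (1 / 2) := fun x hx hxN =>
    ⟨(hF0 (x - 1)).trans_lt ((key x hx (hd x hxN) _).2 (by linarith)),
      ((key x hx (hd x hxN) (x + 1)).1 (by linarith)).trans_le (hF1 _)⟩
  refine ⟨{x | 0 < f x} ∩ Nᶜ, fun x => Q (F x),
    fun x => (Real.exp (-Real.pi * Q (F x) ^ 2))⁻¹ * f x,
    (measurableSet_lt measurable_const hfm).inter hNm.compl, ?_, ?_, ?_⟩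
  · have : ∀ᵐ x, x ∉ N := by rw [ae_iff]; simpa using hN0
    filter_upwards [this] with x hx h using ⟨h, hx⟩
  · rintro x ⟨hx, hxN⟩ y ⟨hy, hyN⟩ hxy
    exact hQm (hFI x hx hxN) (hFI y hy hyN) ((key x hx (hd x hxN) y).1 hxy)
  · rintro x ⟨hx, hxN⟩
    refine ⟨mul_pos (inv_pos.2 (Real.exp_pos _)) hx,
      (hQd _ (hFI x hx hxN)).comp x (hd x hxN), ?_⟩
    rw [mul_inv_cancel_left₀ (Real.exp_pos _).ne']

/-! ### Gaussian integrals in one and two variables -/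

theorem lintegral_gaussian_pi {b : ℝ} (hb : 0 < b) :
    ∫⁻ x : ℝ, ENNReal.ofReal (Real.exp (-Real.pi * (b * x ^ 2))) = ENNReal.ofReal (1 / √b) := by
  have h : ∀ x : ℝ, -Real.pi * (b * x ^ 2) = -(Real.pi * b) * x ^ 2 := fun x => by ring
  simp_rw [h]
  have hpb : 0 < Real.pi * b := mul_pos Real.pi_pos hb
  rw [← ofReal_integral_eq_lintegral_ofReal (integrable_exp_neg_mul_sq hpb)
    (ae_of_all _ fun x => (Real.exp_pos _).le), integral_gaussian]
  congr 1
  rw [← div_div, div_self Real.pi_ne_zero, Real.sqrt_div zero_le_one, Real.sqrt_one]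

theorem lintegral_gaussian_prod {A B C : ℝ} (hA : 0 < A) (hD : 0 < A * C - B ^ 2) :
    ∫⁻ z : ℝ × ℝ, ENNReal.ofReal
        (Real.exp (-Real.pi * (A * z.1 ^ 2 + 2 * B * z.1 * z.2 + C * z.2 ^ 2))) =
      ENNReal.ofReal (1 / √(A * C - B ^ 2)) := by
  rw [Measure.volume_eq_prod, lintegral_prod_symm' _ (by fun_prop)]
  have h : ∀ x y : ℝ, Real.exp (-Real.pi * (A * x ^ 2 + 2 * B * x * y + C * y ^ 2)) =
      Real.exp (-Real.pi * (A * (x + B / A * y) ^ 2)) *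
        Real.exp (-Real.pi * ((A * C - B ^ 2) / A * y ^ 2)) := by
    intro x y
    rw [← Real.exp_add]
    congr 1
    field_simp
    ring
  have inner : ∀ y : ℝ, ∫⁻ x : ℝ, ENNReal.ofReal
      (Real.exp (-Real.pi * (A * x ^ 2 + 2 * B * x * y + C * y ^ 2))) =
      ENNReal.ofReal (1 / √A) *
        ENNReal.ofReal (Real.exp (-Real.pi * ((A * C - B ^ 2) / A * y ^ 2))) := by
    intro y
    simp_rw [h, ENNReal.ofReal_mul (Real.exp_pos _).le]
    rw [lintegral_mul_const _ (by fun_prop),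
      lintegral_add_right_eq_self
        (fun x => ENNReal.ofReal (Real.exp (-Real.pi * (A * x ^ 2)))) (B / A * y),
      lintegral_gaussian_pi hA]
  simp_rw [inner]
  rw [lintegral_const_mul _ (by fun_prop), lintegral_gaussian_pi (div_pos hD hA),
    ← ENNReal.ofReal_mul (by positivity)]
  congr 1
  rw [Real.sqrt_div hD.le]
  have := Real.sqrt_pos.2 hA
  have := Real.sqrt_pos.2 hD
  field_simp

/-! ### The constant and the pointwise transport estimate -/

/-- The value of the constant, for three weights `1 - aᵢ` where `a₁ + a₂ + a₃ = 1`. -/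
noncomputable def gaussianConstant (a₁ a₂ a₃ : ℝ) : ℝ :=
  √((a₁ ^ a₁ * a₂ ^ a₂ * a₃ ^ a₃) /
    ((1 - a₁) ^ (1 - a₁) * (1 - a₂) ^ (1 - a₂) * (1 - a₃) ^ (1 - a₃)))

section

variable {a₁ a₂ a₃ : ℝ} (h₁ : 0 < a₁) (h₂ : 0 < a₂) (h₃ : 0 < a₃) (hs : a₁ + a₂ + a₃ = 1)

include h₁ h₂ h₃ hs

theorem gaussianConstant_pos : 0 < gaussianConstant a₁ a₂ a₃ := by
  have k₁ : 0 < 1 - a₁ := by linarith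
  have k₂ : 0 < 1 - a₂ := by linarith
  have k₃ : 0 < 1 - a₃ := by linarith
  unfold gaussianConstant
  positivity

/-- Writing 1 - a₁ = a₂ + a₃ in the exponents regroups the denominator as a product of ((1 - a_j)(1
- a_l))^{a_i}. Each base exceeds a_i, since (1 - a₂)(1 - a₃) = a₁ + a₂a₃. -/
theorem gaussianConstant_lt_one : gaussianConstant a₁ a₂ a₃ < 1 := by
  have k₁ : 0 < 1 - a₁ := by linarith
  have k₂ : 0 < 1 - a₂ := by linarith
  have k₃ : 0 < 1 - a₃ := by linarith
  unfold gaussianConstant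
  rw [Real.sqrt_lt' one_pos, one_pow, div_lt_one (by positivity)]
  have e : (1 - a₁) ^ (1 - a₁) * (1 - a₂) ^ (1 - a₂) * (1 - a₃) ^ (1 - a₃) =
      ((1 - a₂) * (1 - a₃)) ^ a₁ * ((1 - a₁) * (1 - a₃)) ^ a₂ * ((1 - a₁) * (1 - a₂)) ^ a₃ := by
    rw [Real.mul_rpow k₂.le k₃.le, Real.mul_rpow k₁.le k₃.le, Real.mul_rpow k₁.le k₂.le]
    conv_lhs =>
      rw [show (1 - a₁) ^ (1 - a₁) = (1 - a₁) ^ (a₂ + a₃) by congr 1; linarith,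
        show (1 - a₂) ^ (1 - a₂) = (1 - a₂) ^ (a₁ + a₃) by congr 1; linarith,
        show (1 - a₃) ^ (1 - a₃) = (1 - a₃) ^ (a₁ + a₂) by congr 1; linarith,
        Real.rpow_add k₁, Real.rpow_add k₂, Real.rpow_add k₃]
    ring
  rw [e]
  have m₁ : a₁ < (1 - a₂) * (1 - a₃) := by nlinarith [mul_pos h₂ h₃]
  have m₂ : a₂ < (1 - a₁) * (1 - a₃) := by nlinarith [mul_pos h₁ h₃]
  have m₃ : a₃ < (1 - a₁) * (1 - a₂) := by nlinarith [mul_pos h₁ h₂]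
  have := Real.rpow_lt_rpow h₁.le m₁ h₁
  have := Real.rpow_lt_rpow h₂.le m₂ h₂
  have := Real.rpow_lt_rpow h₃.le m₃ h₃
  gcongr

/-- Normalisation of the k_i: it turns the AM-GM constant times the Gaussian integral √(a₁a₂a₃) into
K. After taking logarithms it is a linear identity in log a_i and log (1 - a_i). -/
theorem gaussianConstant_eq_prod :
    gaussianConstant a₁ a₂ a₃ * (√((1 - a₁) * (a₂ * a₃)) ^ (1 - a₁) *
      √((1 - a₂) * (a₁ * a₃)) ^ (1 - a₂) * √((1 - a₃) * (a₁ * a₂)) ^ (1 - a₃)) =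
      a₁ ^ a₁ * a₂ ^ a₂ * a₃ ^ a₃ * √(a₁ * a₂ * a₃) := by
  have k₁ : 0 < 1 - a₁ := by linarith
  have k₂ : 0 < 1 - a₂ := by linarith
  have k₃ : 0 < 1 - a₃ := by linarith
  have hK := gaussianConstant_pos h₁ h₂ h₃ hs
  refine Real.log_injOn_pos (Set.mem_Ioi.2 (by positivity)) (Set.mem_Ioi.2 (by positivity)) ?_
  unfold gaussianConstant at hK ⊢
  obtain ⟨c₁, hc₁⟩ : ∃ c, c = 1 - a₁ := ⟨_, rfl⟩
  obtain ⟨c₂, hc₂⟩ : ∃ c, c = 1 - a₂ := ⟨_, rfl⟩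
  obtain ⟨c₃, hc₃⟩ : ∃ c, c = 1 - a₃ := ⟨_, rfl⟩
  rw [← hc₁] at k₁ hK ⊢
  rw [← hc₂] at k₂ hK ⊢
  rw [← hc₃] at k₃ hK ⊢
  rw [Real.log_mul hK.ne' (by positivity), Real.log_sqrt (by positivity),
    Real.log_div (by positivity) (by positivity)]
  simp (disch := positivity) only [Real.log_mul, Real.log_rpow, Real.log_sqrt]
  have e₁ : a₁ = 1 - c₁ := by linarith
  have e₂ : a₂ = 1 - c₂ := by linarith
  have e₃ : a₃ = c₁ + c₂ - 1 := by linarith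
  have e₄ : c₃ = 2 - c₁ - c₂ := by linarith
  generalize Real.log a₁ = l₁, Real.log a₂ = l₂, Real.log a₃ = l₃, Real.log c₁ = n₁,
    Real.log c₂ = n₂, Real.log c₃ = n₃
  subst e₁ e₂ e₃ e₄
  ring

/-- AM-GM with weights a_i applied to w_j w_l / a_i; the exponent of w₁ is a₂ + a₃ = 1 - a₁.
Equality holds when the w_i are proportional to 1 / a_i. -/
theorem prod_rpow_le_pairs {w₁ w₂ w₃ : ℝ} (hw₁ : 0 < w₁) (hw₂ : 0 < w₂) (hw₃ : 0 < w₃) :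
    w₁ ^ (1 - a₁) * w₂ ^ (1 - a₂) * w₃ ^ (1 - a₃) ≤
      a₁ ^ a₁ * a₂ ^ a₂ * a₃ ^ a₃ * (w₁ * w₂ + w₁ * w₃ + w₂ * w₃) := by
  have := Real.geom_mean_le_arith_mean3_weighted h₁.le h₂.le h₃.le
    (p₁ := w₂ * w₃ / a₁) (p₂ := w₁ * w₃ / a₂) (p₃ := w₁ * w₂ / a₃)
    (by positivity) (by positivity) (by positivity) hs
  rw [mul_div_cancel₀ _ h₁.ne', mul_div_cancel₀ _ h₂.ne', mul_div_cancel₀ _ h₃.ne',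
    Real.div_rpow (by positivity) h₁.le, Real.div_rpow (by positivity) h₂.le,
    Real.div_rpow (by positivity) h₃.le, Real.mul_rpow hw₂.le hw₃.le,
    Real.mul_rpow hw₁.le hw₃.le, Real.mul_rpow hw₁.le hw₂.le] at this
  have e : w₁ ^ (1 - a₁) * w₂ ^ (1 - a₂) * w₃ ^ (1 - a₃) = a₁ ^ a₁ * a₂ ^ a₂ * a₃ ^ a₃ *
      (w₂ ^ a₁ * w₃ ^ a₁ / a₁ ^ a₁ * (w₁ ^ a₂ * w₃ ^ a₂ / a₂ ^ a₂) *
        (w₁ ^ a₃ * w₂ ^ a₃ / a₃ ^ a₃)) := by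
    rw [show 1 - a₁ = a₂ + a₃ by linarith, show 1 - a₂ = a₁ + a₃ by linarith,
      show 1 - a₃ = a₁ + a₂ by linarith, Real.rpow_add hw₁, Real.rpow_add hw₂, Real.rpow_add hw₃]
    have := Real.rpow_pos_of_pos h₁ a₁
    have := Real.rpow_pos_of_pos h₂ a₂
    have := Real.rpow_pos_of_pos h₃ a₃
    field_simp
  rw [e]
  refine mul_le_mul_of_nonneg_left (this.trans (le_of_eq (by ring))) (by positivity)

/-- The heart of the argument: t_i and d_i stand for T_i and T_i' at B_i z, and v for S(z). The
exponentials and the derivatives are estimated separately. -/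
theorem prod_gaussian_transport_le {t₁ t₂ t₃ d₁ d₂ d₃ : ℝ} (hd₁ : 0 < d₁) (hd₂ : 0 < d₂)
    (hd₃ : 0 < d₃) {k₁ k₂ k₃ : ℝ} (hk₁ : k₁ = √((1 - a₁) * (a₂ * a₃)))
    (hk₂ : k₂ = √((1 - a₂) * (a₁ * a₃))) (hk₃ : k₃ = √((1 - a₃) * (a₁ * a₂))) {v₁ v₂ : ℝ}
    (hv₁ : v₁ = k₁ * t₁ + k₃ * t₃) (hv₂ : v₂ = k₁ * t₁ + k₂ * t₂) :
    (Real.exp (-Real.pi * t₁ ^ 2) * d₁) ^ (1 - a₁) *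
      (Real.exp (-Real.pi * t₂ ^ 2) * d₂) ^ (1 - a₂) *
      (Real.exp (-Real.pi * t₃ ^ 2) * d₃) ^ (1 - a₃) ≤
    gaussianConstant a₁ a₂ a₃ / √(a₁ * a₂ * a₃) *
      (k₁ * d₁ * (k₂ * d₂) + k₁ * d₁ * (k₃ * d₃) + k₂ * d₂ * (k₃ * d₃)) *
      Real.exp (-Real.pi * ((1 - a₃) / (a₁ * a₂) * v₁ ^ 2 + 2 * (-(1 / a₁)) * v₁ * v₂ +
        (1 - a₂) / (a₁ * a₃) * v₂ ^ 2)) := by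
  have c₁ : 0 < 1 - a₁ := by linarith
  have c₂ : 0 < 1 - a₂ := by linarith
  have c₃ : 0 < 1 - a₃ := by linarith
  have p₁ : 0 < k₁ := by rw [hk₁]; positivity
  have p₂ : 0 < k₂ := by rw [hk₂]; positivity
  have p₃ : 0 < k₃ := by rw [hk₃]; positivity
  have q₁ : k₁ ^ 2 = (1 - a₁) * (a₂ * a₃) := by rw [hk₁, Real.sq_sqrt (by positivity)]
  have q₂ : k₂ ^ 2 = (1 - a₂) * (a₁ * a₃) := by rw [hk₂, Real.sq_sqrt (by positivity)]
  have q₃ : k₃ ^ 2 = (1 - a₃) * (a₁ * a₂) := by rw [hk₃, Real.sq_sqrt (by positivity)]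
  have hK := gaussianConstant_eq_prod h₁ h₂ h₃ hs
  rw [← hk₁, ← hk₂, ← hk₃] at hK
  have amgm := prod_rpow_le_pairs h₁ h₂ h₃ hs (mul_pos p₁ hd₁) (mul_pos p₂ hd₂) (mul_pos p₃ hd₃)
  have hquad : (1 - a₃) / (a₁ * a₂) * v₁ ^ 2 + 2 * (-(1 / a₁)) * v₁ * v₂ +
      (1 - a₂) / (a₁ * a₃) * v₂ ^ 2 ≤
      t₁ ^ 2 * (1 - a₁) + t₂ ^ 2 * (1 - a₂) + t₃ ^ 2 * (1 - a₃) := by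
    -- The form in v is the minimum of Σ (1 - a_i) t_i² over all t with the given v. One degree of
    -- freedom remains, so the defect is a single square.
    have e : t₁ ^ 2 * (1 - a₁) + t₂ ^ 2 * (1 - a₂) + t₃ ^ 2 * (1 - a₃) -
        ((1 - a₃) / (a₁ * a₂) * v₁ ^ 2 + 2 * (-(1 / a₁)) * v₁ * v₂ +
          (1 - a₂) / (a₁ * a₃) * v₂ ^ 2) =
        (a₁ * (k₁ * t₁) - a₂ * (k₂ * t₂) - a₃ * (k₃ * t₃)) ^ 2 / (a₁ * a₂ * a₃) := by
      have r₁ : t₁ ^ 2 * (1 - a₁) = (k₁ * t₁) ^ 2 / (a₂ * a₃) := by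
        rw [mul_pow, q₁]; field_simp
      have r₂ : t₂ ^ 2 * (1 - a₂) = (k₂ * t₂) ^ 2 / (a₁ * a₃) := by
        rw [mul_pow, q₂]; field_simp
      have r₃ : t₃ ^ 2 * (1 - a₃) = (k₃ * t₃) ^ 2 / (a₁ * a₂) := by
        rw [mul_pow, q₃]; field_simp
      rw [r₁, r₂, r₃, hv₁, hv₂]
      generalize k₁ * t₁ = u₁, k₂ * t₂ = u₂, k₃ * t₃ = u₃
      field_simp
      obtain rfl : a₃ = 1 - a₁ - a₂ := by linarith
      ring
    have : 0 ≤ (a₁ * (k₁ * t₁) - a₂ * (k₂ * t₂) - a₃ * (k₃ * t₃)) ^ 2 / (a₁ * a₂ * a₃) := by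
      positivity
    linarith
  rw [Real.mul_rpow p₁.le hd₁.le, Real.mul_rpow p₂.le hd₂.le, Real.mul_rpow p₃.le hd₃.le] at amgm
  rw [Real.mul_rpow (Real.exp_pos _).le hd₁.le, Real.mul_rpow (Real.exp_pos _).le hd₂.le,
    Real.mul_rpow (Real.exp_pos _).le hd₃.le, ← Real.exp_mul, ← Real.exp_mul, ← Real.exp_mul]
  have hexp : Real.exp (-Real.pi * t₁ ^ 2 * (1 - a₁)) * Real.exp (-Real.pi * t₂ ^ 2 * (1 - a₂)) *
      Real.exp (-Real.pi * t₃ ^ 2 * (1 - a₃)) ≤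
      Real.exp (-Real.pi * ((1 - a₃) / (a₁ * a₂) * v₁ ^ 2 + 2 * (-(1 / a₁)) * v₁ * v₂ +
        (1 - a₂) / (a₁ * a₃) * v₂ ^ 2)) := by
    rw [← Real.exp_add, ← Real.exp_add]
    refine Real.exp_le_exp.2 ?_
    have := mul_le_mul_of_nonneg_left hquad Real.pi_pos.le
    linarith
  have hdet : d₁ ^ (1 - a₁) * d₂ ^ (1 - a₂) * d₃ ^ (1 - a₃) ≤
      gaussianConstant a₁ a₂ a₃ / √(a₁ * a₂ * a₃) *
      (k₁ * d₁ * (k₂ * d₂) + k₁ * d₁ * (k₃ * d₃) + k₂ * d₂ * (k₃ * d₃)) := by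
    have hθ : 0 < √(a₁ * a₂ * a₃) := by positivity
    have hk : 0 < k₁ ^ (1 - a₁) * k₂ ^ (1 - a₂) * k₃ ^ (1 - a₃) := by positivity
    rw [← mul_le_mul_iff_right₀ hk]
    refine (le_of_eq (by ring)).trans (amgm.trans (le_of_eq ?_))
    rw [eq_div_of_mul_eq hθ.ne' hK.symm]
    ring
  calc _ = (Real.exp (-Real.pi * t₁ ^ 2 * (1 - a₁)) * Real.exp (-Real.pi * t₂ ^ 2 * (1 - a₂)) *
      Real.exp (-Real.pi * t₃ ^ 2 * (1 - a₃))) *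
      (d₁ ^ (1 - a₁) * d₂ ^ (1 - a₂) * d₃ ^ (1 - a₃)) := by ring
    _ ≤ _ := mul_le_mul hexp hdet (by positivity) (Real.exp_pos _).le
    _ = _ := mul_comm _ _

end

/-! ### The trilinear inequality -/

theorem quasiMeasurePreserving_add_prod :
    Measure.QuasiMeasurePreserving (fun z : ℝ × ℝ => z.1 + z.2) volume volume :=
  (Measure.quasiMeasurePreserving_snd (μ := (volume : Measure ℝ)) (ν := (volume : Measure ℝ))).comp
    (measurePreserving_prod_add volume volume).quasiMeasurePreserving

theorem trilinear_of_integral_eq_one {a₁ a₂ a₃ : ℝ} (h₁ : 0 < a₁) (h₂ : 0 < a₂) (h₃ : 0 < a₃)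
    (hs : a₁ + a₂ + a₃ = 1) {f g h : ℝ → ℝ} (hf0 : ∀ x, 0 ≤ f x) (hg0 : ∀ x, 0 ≤ g x)
    (hh0 : ∀ x, 0 ≤ h x) (hfm : Measurable f) (hgm : Measurable g) (hhm : Measurable h)
    (hfi : Integrable f) (hgi : Integrable g) (hhi : Integrable h)
    (hf1 : ∫ x, f x = 1) (hg1 : ∫ x, g x = 1) (hh1 : ∫ x, h x = 1) :
    ∫⁻ z : ℝ × ℝ, ENNReal.ofReal
        (f (z.1 + z.2) ^ (1 - a₁) * g z.2 ^ (1 - a₂) * h z.1 ^ (1 - a₃)) ≤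
      ENNReal.ofReal (gaussianConstant a₁ a₂ a₃) := by
  have c₁ : 0 < 1 - a₁ := by linarith
  have c₂ : 0 < 1 - a₂ := by linarith
  have c₃ : 0 < 1 - a₃ := by linarith
  obtain ⟨s₁, T₁, D₁, hs₁, hae₁, hm₁, hT₁⟩ := exists_gaussian_transport hf0 hfm hfi hf1
  obtain ⟨s₂, T₂, D₂, hs₂, hae₂, hm₂, hT₂⟩ := exists_gaussian_transport hg0 hgm hgi hg1
  obtain ⟨s₃, T₃, D₃, hs₃, hae₃, hm₃, hT₃⟩ := exists_gaussian_transport hh0 hhm hhi hh1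
  obtain ⟨k₁, hk₁⟩ : ∃ k, k = √((1 - a₁) * (a₂ * a₃)) := ⟨_, rfl⟩
  obtain ⟨k₂, hk₂⟩ : ∃ k, k = √((1 - a₂) * (a₁ * a₃)) := ⟨_, rfl⟩
  obtain ⟨k₃, hk₃⟩ : ∃ k, k = √((1 - a₃) * (a₁ * a₂)) := ⟨_, rfl⟩
  have p₁ : 0 < k₁ := by rw [hk₁]; positivity
  have p₂ : 0 < k₂ := by rw [hk₂]; positivity
  have p₃ : 0 < k₃ := by rw [hk₃]; positivity
  set E : Set (ℝ × ℝ) := {z | z.1 + z.2 ∈ s₁ ∧ z.2 ∈ s₂ ∧ z.1 ∈ s₃} with hE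
  have hEm : MeasurableSet E :=
    ((measurable_fst.add measurable_snd) hs₁).inter ((measurable_snd hs₂).inter (measurable_fst hs₃))
  set S : ℝ × ℝ → ℝ × ℝ := fun z =>
    (k₁ * T₁ (z.1 + z.2) + k₃ * T₃ z.1, k₁ * T₁ (z.1 + z.2) + k₂ * T₂ z.2) with hS
  set S' : ℝ × ℝ → ℝ × ℝ →L[ℝ] ℝ × ℝ := fun z =>
    (Matrix.toLin (.finTwoProd ℝ) (.finTwoProd ℝ)
      !![k₁ * D₁ (z.1 + z.2) + k₃ * D₃ z.1, k₁ * D₁ (z.1 + z.2);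
        k₁ * D₁ (z.1 + z.2), k₁ * D₁ (z.1 + z.2) + k₂ * D₂ z.2]).toContinuousLinearMap with hS'
  have hSd : ∀ z ∈ E, HasFDerivWithinAt S (S' z) E z := by
    rintro z ⟨hz₁, hz₂, hz₃⟩
    refine HasFDerivAt.hasFDerivWithinAt ?_
    have e₁ : HasFDerivAt (fun z : ℝ × ℝ => T₁ (z.1 + z.2)) _ z :=
      HasDerivAt.comp_hasFDerivAt z (hT₁ _ hz₁).2.1
        ((hasFDerivAt_fst (𝕜 := ℝ) (p := z)).add (hasFDerivAt_snd (𝕜 := ℝ) (p := z)))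
    have e₂ : HasFDerivAt (fun z : ℝ × ℝ => T₂ z.2) _ z :=
      HasDerivAt.comp_hasFDerivAt z (hT₂ _ hz₂).2.1 (hasFDerivAt_snd (𝕜 := ℝ) (p := z))
    have e₃ : HasFDerivAt (fun z : ℝ × ℝ => T₃ z.1) _ z :=
      HasDerivAt.comp_hasFDerivAt z (hT₃ _ hz₃).2.1 (hasFDerivAt_fst (𝕜 := ℝ) (p := z))
    have e := ((e₁.const_mul k₁).add (e₃.const_mul k₃)).prodMk
      ((e₁.const_mul k₁).add (e₂.const_mul k₂))
    refine e.congr_fderiv ?_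
    simp only [hS']
    rw [Matrix.toLin_finTwoProd_toContinuousLinearMap]
    ext <;> simp
  have hdet : ∀ z, (S' z).det = k₁ * D₁ (z.1 + z.2) * (k₂ * D₂ z.2) +
      k₁ * D₁ (z.1 + z.2) * (k₃ * D₃ z.1) + k₂ * D₂ z.2 * (k₃ * D₃ z.1) := by
    intro z
    rw [hS', ContinuousLinearMap.det, LinearMap.coe_toContinuousLinearMap, LinearMap.det_toLin,
      Matrix.det_fin_two_of]
    ring
  -- If S takes equal values and x < x', the first coordinate forces T₁ to decrease, hence x' + y' <
  -- x + y and y' < y. Then both terms of the second coordinate decrease strictly, a contradiction.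
  -- The case y < y' is symmetric.
  have hinj : Set.InjOn S E := by
    have aux : ∀ z ∈ E, ∀ z' ∈ E, S z = S z' → ¬ z.1 < z'.1 := by
      rintro ⟨x, y⟩ ⟨hx₁, hx₂, hx₃⟩ ⟨x', y'⟩ ⟨hx₁', hx₂', hx₃'⟩ he hlt
      simp only [hS, Prod.mk.injEq] at he hlt hx₁ hx₂ hx₃ hx₁' hx₂' hx₃'
      have i₃ := mul_lt_mul_of_pos_left (hm₃ hx₃ hx₃' hlt) p₃
      have i₁ : k₁ * T₁ (x' + y') < k₁ * T₁ (x + y) := by linarith [he.1]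
      have j₁ := (hm₁.lt_iff_lt hx₁' hx₁).1 (lt_of_mul_lt_mul_left i₁ p₁.le)
      have i₂ := mul_lt_mul_of_pos_left (hm₂ hx₂' hx₂ (by linarith : y' < y)) p₂
      linarith [he.2]
    have aux' : ∀ z ∈ E, ∀ z' ∈ E, S z = S z' → ¬ z.2 < z'.2 := by
      rintro ⟨x, y⟩ ⟨hx₁, hx₂, hx₃⟩ ⟨x', y'⟩ ⟨hx₁', hx₂', hx₃'⟩ he hlt
      simp only [hS, Prod.mk.injEq] at he hlt hx₁ hx₂ hx₃ hx₁' hx₂' hx₃'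
      have i₂ := mul_lt_mul_of_pos_left (hm₂ hx₂ hx₂' hlt) p₂
      have i₁ : k₁ * T₁ (x' + y') < k₁ * T₁ (x + y) := by linarith [he.2]
      have j₁ := (hm₁.lt_iff_lt hx₁' hx₁).1 (lt_of_mul_lt_mul_left i₁ p₁.le)
      have i₃ := mul_lt_mul_of_pos_left (hm₃ hx₃' hx₃ (by linarith : x' < x)) p₃
      linarith [he.1]
    intro z hz z' hz' he
    exact Prod.ext
      (le_antisymm (not_lt.1 (aux z' hz' z hz he.symm)) (not_lt.1 (aux z hz z' hz' he)))
      (le_antisymm (not_lt.1 (aux' z' hz' z hz he.symm)) (not_lt.1 (aux' z hz z' hz' he)))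
  set γ : ℝ × ℝ → ENNReal := fun v => ENNReal.ofReal
    (Real.exp (-Real.pi * ((1 - a₃) / (a₁ * a₂) * v.1 ^ 2 + 2 * (-(1 / a₁)) * v.1 * v.2 +
      (1 - a₂) / (a₁ * a₃) * v.2 ^ 2))) with hγ
  set M : ℝ := gaussianConstant a₁ a₂ a₃ / √(a₁ * a₂ * a₃) with hM
  have hK := gaussianConstant_pos h₁ h₂ h₃ hs
  have hMpos : 0 < M := by positivity
  set P : ℝ × ℝ → ENNReal := fun z => ENNReal.ofReal
    (f (z.1 + z.2) ^ (1 - a₁) * g z.2 ^ (1 - a₂) * h z.1 ^ (1 - a₃)) with hP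
  have hdisc : (1 - a₃) / (a₁ * a₂) * ((1 - a₂) / (a₁ * a₃)) - (-(1 / a₁)) ^ 2 =
      1 / (a₁ * a₂ * a₃) := by
    field_simp
    obtain rfl : a₃ = 1 - a₁ - a₂ := by linarith
    ring
  have hγint : ∫⁻ v, γ v = ENNReal.ofReal √(a₁ * a₂ * a₃) := by
    rw [hγ, lintegral_gaussian_prod (by positivity) (by rw [hdisc]; positivity), hdisc]
    congr 1
    rw [one_div (a₁ * a₂ * a₃), Real.sqrt_inv, one_div, inv_inv]
  -- Almost everywhere off E one of the three functions vanishes, and its power vanishes because its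
  -- exponent is positive.
  have hzero : ∀ᵐ z, z ∉ E → P z = 0 := by
    filter_upwards [quasiMeasurePreserving_add_prod.ae hae₁,
      (Measure.quasiMeasurePreserving_snd (μ := (volume : Measure ℝ))
        (ν := (volume : Measure ℝ))).ae hae₂,
      (Measure.quasiMeasurePreserving_fst (μ := (volume : Measure ℝ))
        (ν := (volume : Measure ℝ))).ae hae₃] with z hz₁ hz₂ hz₃ hz
    rw [hP]
    simp only [ENNReal.ofReal_eq_zero]
    by_contra! hpos
    have n₁ : f (z.1 + z.2) ≠ 0 := fun h0 => by simp [h0, Real.zero_rpow c₁.ne'] at hpos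
    have n₂ : g z.2 ≠ 0 := fun h0 => by simp [h0, Real.zero_rpow c₂.ne'] at hpos
    have n₃ : h z.1 ≠ 0 := fun h0 => by simp [h0, Real.zero_rpow c₃.ne'] at hpos
    exact hz ⟨hz₁ ((hf0 _).lt_of_ne' n₁), hz₂ ((hg0 _).lt_of_ne' n₂), hz₃ ((hh0 _).lt_of_ne' n₃)⟩
  calc ∫⁻ z, P z ≤ ∫⁻ z, E.indicator P z := by
        refine lintegral_mono_ae ?_
        filter_upwards [hzero] with z hz
        by_cases hzE : z ∈ E
        · rw [Set.indicator_of_mem hzE]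
        · rw [hz hzE]; exact zero_le
    _ = ∫⁻ z in E, P z := lintegral_indicator hEm _
    _ ≤ ∫⁻ z in E, ENNReal.ofReal M * (ENNReal.ofReal |(S' z).det| * γ (S z)) := by
        refine setLIntegral_mono' hEm ?_
        rintro z ⟨hz₁, hz₂, hz₃⟩
        obtain ⟨d₁, -, e₁⟩ := hT₁ _ hz₁
        obtain ⟨d₂, -, e₂⟩ := hT₂ _ hz₂
        obtain ⟨d₃, -, e₃⟩ := hT₃ _ hz₃
        rw [hP, hγ]
        simp only
        rw [← ENNReal.ofReal_mul (abs_nonneg _), ← ENNReal.ofReal_mul hMpos.le, hdet,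
          abs_of_pos (by positivity), e₁, e₂, e₃, ← mul_assoc]
        exact ENNReal.ofReal_le_ofReal
          (prod_gaussian_transport_le h₁ h₂ h₃ hs d₁ d₂ d₃ hk₁ hk₂ hk₃ rfl rfl)
    _ = ENNReal.ofReal M * ∫⁻ v in S '' E, γ v := by
        rw [lintegral_const_mul' _ _ ENNReal.ofReal_ne_top,
          lintegral_image_eq_lintegral_abs_det_fderiv_mul _ hEm hSd hinj]
    -- Surjectivity of S is not needed: enlarging the image only increases the bound.
    _ ≤ ENNReal.ofReal M * ∫⁻ v, γ v := by gcongr; exact Measure.restrict_le_self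
    _ = ENNReal.ofReal (gaussianConstant a₁ a₂ a₃) := by
        rw [hγint, ← ENNReal.ofReal_mul hMpos.le, hM, div_mul_cancel₀ _ (by positivity)]

theorem exists_measurable_nonneg_ae_eq {f : ℝ → ℝ} (hf0 : ∀ x, 0 ≤ f x) (hfi : Integrable f) :
    ∃ f' : ℝ → ℝ, Measurable f' ∧ (∀ x, 0 ≤ f' x) ∧ f =ᵐ[volume] f' := by
  refine ⟨fun x => max (hfi.1.aemeasurable.mk f x) 0,
    hfi.1.aemeasurable.measurable_mk.max measurable_const, fun x => le_max_right _ _, ?_⟩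
  filter_upwards [hfi.1.aemeasurable.ae_eq_mk] with x hx
  rw [← hx, max_eq_left (hf0 x)]

/-- If two triples of functions agree almost everywhere, so do the integrands of the trilinear
form. -/
theorem trilinear_integrand_ae_eq {f g h f' g' h' : ℝ → ℝ} (hf : f =ᵐ[volume] f')
    (hg : g =ᵐ[volume] g') (hh : h =ᵐ[volume] h') (c₁ c₂ c₃ : ℝ) :
    (fun z : ℝ × ℝ => ENNReal.ofReal (f (z.1 + z.2) ^ c₁ * g z.2 ^ c₂ * h z.1 ^ c₃)) =ᵐ[volume]
      fun z => ENNReal.ofReal (f' (z.1 + z.2) ^ c₁ * g' z.2 ^ c₂ * h' z.1 ^ c₃) := by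
  filter_upwards [quasiMeasurePreserving_add_prod.ae hf,
    (Measure.quasiMeasurePreserving_snd (μ := (volume : Measure ℝ))
      (ν := (volume : Measure ℝ))).ae hg,
    (Measure.quasiMeasurePreserving_fst (μ := (volume : Measure ℝ))
      (ν := (volume : Measure ℝ))).ae hh] with z hz₁ hz₂ hz₃
  rw [hz₁, hz₂, hz₃]

theorem trilinearInequality_gaussianConstant {a₁ a₂ a₃ : ℝ} (h₁ : 0 < a₁) (h₂ : 0 < a₂)
    (h₃ : 0 < a₃) (hs : a₁ + a₂ + a₃ = 1) :
    TrilinearInequality (1 - a₁) (1 - a₂) (1 - a₃) (gaussianConstant a₁ a₂ a₃) := by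
  have c₁ : 0 < 1 - a₁ := by linarith
  have c₂ : 0 < 1 - a₂ := by linarith
  have c₃ : 0 < 1 - a₃ := by linarith
  have hK := gaussianConstant_pos h₁ h₂ h₃ hs
  intro f g h hf0 hg0 hh0 hfi hgi hhi
  -- Transport needs Borel functions of integral 1: pass to measurable representatives, dispose of
  -- functions that vanish almost everywhere, and rescale.
  obtain ⟨f', hfm, hf0', hff⟩ := exists_measurable_nonneg_ae_eq hf0 hfi
  obtain ⟨g', hgm, hg0', hgg⟩ := exists_measurable_nonneg_ae_eq hg0 hgi
  obtain ⟨h', hhm, hh0', hhh⟩ := exists_measurable_nonneg_ae_eq hh0 hhi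
  have zero_case : ∀ u : ℝ → ℝ, (∀ x, 0 ≤ u x) → Integrable u → ¬ 0 < ∫ x, u x →
      u =ᵐ[volume] fun _ => 0 := fun u hu0 hui hu =>
    (integral_eq_zero_iff_of_nonneg hu0 hui).1
      (le_antisymm (not_lt.1 hu) (integral_nonneg hu0))
  by_cases hf : 0 < ∫ x, f x
  swap
  · rw [lintegral_congr_ae (trilinear_integrand_ae_eq (zero_case f hf0 hfi hf) hgg hhh _ _ _)]
    simp [Real.zero_rpow c₁.ne']
  by_cases hg : 0 < ∫ x, g x
  swap
  · rw [lintegral_congr_ae (trilinear_integrand_ae_eq hff (zero_case g hg0 hgi hg) hhh _ _ _)]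
    simp [Real.zero_rpow c₂.ne']
  by_cases hh : 0 < ∫ x, h x
  swap
  · rw [lintegral_congr_ae (trilinear_integrand_ae_eq hff hgg (zero_case h hh0 hhi hh) _ _ _)]
    simp [Real.zero_rpow c₃.ne']
  rw [lintegral_congr_ae (trilinear_integrand_ae_eq hff hgg hhh _ _ _)]
  have hfi' := hfi.congr hff
  have hgi' := hgi.congr hgg
  have hhi' := hhi.congr hhh
  have ef := integral_congr_ae hff
  have eg := integral_congr_ae hgg
  have eh := integral_congr_ae hhh
  set I := ∫ x, f x with hI
  set J := ∫ x, g x with hJ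
  set L := ∫ x, h x with hL
  have key := trilinear_of_integral_eq_one h₁ h₂ h₃ hs
    (f := fun x => f' x / I) (g := fun x => g' x / J) (h := fun x => h' x / L)
    (fun x => div_nonneg (hf0' x) hf.le) (fun x => div_nonneg (hg0' x) hg.le)
    (fun x => div_nonneg (hh0' x) hh.le)
    (hfm.div_const _) (hgm.div_const _) (hhm.div_const _)
    (hfi'.div_const _) (hgi'.div_const _) (hhi'.div_const _)
    (by rw [integral_div, ← ef, div_self hf.ne']) (by rw [integral_div, ← eg, div_self hg.ne'])
    (by rw [integral_div, ← eh, div_self hh.ne'])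
  have hpos : 0 < I ^ (1 - a₁) * J ^ (1 - a₂) * L ^ (1 - a₃) := by positivity
  have e : ∀ z : ℝ × ℝ,
      ENNReal.ofReal (f' (z.1 + z.2) ^ (1 - a₁) * g' z.2 ^ (1 - a₂) * h' z.1 ^ (1 - a₃)) =
      ENNReal.ofReal (I ^ (1 - a₁) * J ^ (1 - a₂) * L ^ (1 - a₃)) * ENNReal.ofReal
        ((f' (z.1 + z.2) / I) ^ (1 - a₁) * (g' z.2 / J) ^ (1 - a₂) * (h' z.1 / L) ^ (1 - a₃)) := by
    intro z
    rw [← ENNReal.ofReal_mul hpos.le, Real.div_rpow (hf0' _) hf.le, Real.div_rpow (hg0' _) hg.le,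
      Real.div_rpow (hh0' _) hh.le]
    congr 1
    field_simp
  simp_rw [e]
  rw [lintegral_const_mul' _ _ ENNReal.ofReal_ne_top, mul_comm (gaussianConstant _ _ _),
    ENNReal.ofReal_mul hpos.le]
  gcongr

/-! ### Sharpness on Gaussians -/

/-- Equality in the trilinear inequality for the extremal Gaussians: the square roots on the left
are their integrals, and the right-hand side is the value of the form. -/
theorem gaussianConstant_mul_sqrt_prod {a₁ a₂ a₃ : ℝ} (h₁ : 0 < a₁) (h₂ : 0 < a₂)
    (h₃ : 0 < a₃) (hs : a₁ + a₂ + a₃ = 1) :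
    gaussianConstant a₁ a₂ a₃ * (√((1 - a₁) / (a₂ * a₃)) ^ (1 - a₁) *
      √((1 - a₂) / (a₁ * a₃)) ^ (1 - a₂) * √((1 - a₃) / (a₁ * a₂)) ^ (1 - a₃)) =
      1 / √(a₁ * a₂ * a₃) := by
  have k₁ : 0 < 1 - a₁ := by linarith
  have k₂ : 0 < 1 - a₂ := by linarith
  have k₃ : 0 < 1 - a₃ := by linarith
  have hK := gaussianConstant_pos h₁ h₂ h₃ hs
  refine Real.log_injOn_pos (Set.mem_Ioi.2 (by positivity)) (Set.mem_Ioi.2 (by positivity)) ?_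
  unfold gaussianConstant at hK ⊢
  obtain ⟨c₁, hc₁⟩ : ∃ c, c = 1 - a₁ := ⟨_, rfl⟩
  obtain ⟨c₂, hc₂⟩ : ∃ c, c = 1 - a₂ := ⟨_, rfl⟩
  obtain ⟨c₃, hc₃⟩ : ∃ c, c = 1 - a₃ := ⟨_, rfl⟩
  rw [← hc₁] at k₁ hK ⊢
  rw [← hc₂] at k₂ hK ⊢
  rw [← hc₃] at k₃ hK ⊢
  rw [Real.log_mul hK.ne' (by positivity), Real.log_sqrt (by positivity)]
  simp (disch := positivity) only [Real.log_div, Real.log_mul, Real.log_rpow, Real.log_sqrt,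
    Real.log_one]
  have e₁ : a₁ = 1 - c₁ := by linarith
  have e₂ : a₂ = 1 - c₂ := by linarith
  have e₃ : a₃ = c₁ + c₂ - 1 := by linarith
  have e₄ : c₃ = 2 - c₁ - c₂ := by linarith
  generalize Real.log a₁ = l₁, Real.log a₂ = l₂, Real.log a₃ = l₃, Real.log c₁ = n₁,
    Real.log c₂ = n₂, Real.log c₃ = n₃
  subst e₁ e₂ e₃ e₄
  ring

theorem gaussianConstant_le_of_trilinearInequality {a₁ a₂ a₃ : ℝ} (h₁ : 0 < a₁) (h₂ : 0 < a₂)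
    (h₃ : 0 < a₃) (hs : a₁ + a₂ + a₃ = 1) {C : ℝ}
    (hC : TrilinearInequality (1 - a₁) (1 - a₂) (1 - a₃) C) : gaussianConstant a₁ a₂ a₃ ≤ C := by
  have c₁ : 0 < 1 - a₁ := by linarith
  have c₂ : 0 < 1 - a₂ := by linarith
  have c₃ : 0 < 1 - a₃ := by linarith
  -- These rates b_i make both transport estimates equalities; raising to the power 1 - a_i cancels
  -- the denominators.
  have b₁ : 0 < a₂ * a₃ / (1 - a₁) := by positivity
  have b₂ : 0 < a₁ * a₃ / (1 - a₂) := by positivity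
  have b₃ : 0 < a₁ * a₂ / (1 - a₃) := by positivity
  have hpos : ∀ b x : ℝ, 0 ≤ Real.exp (-(Real.pi * b) * x ^ 2) := fun _ _ => (Real.exp_pos _).le
  have hint : ∀ b : ℝ, 0 < b → Integrable fun x : ℝ => Real.exp (-(Real.pi * b) * x ^ 2) :=
    fun b hb => integrable_exp_neg_mul_sq (mul_pos Real.pi_pos hb)
  have hval : ∀ m c : ℝ, ∫ x : ℝ, Real.exp (-(Real.pi * (m / c)) * x ^ 2) = √(c / m) := by
    intro m c
    rw [integral_gaussian, ← div_div, div_self Real.pi_ne_zero, one_div_div]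
  have h := hC _ _ _ (hpos _) (hpos _) (hpos _) (hint _ b₁) (hint _ b₂) (hint _ b₃)
  rw [hval, hval, hval] at h
  have e : ∀ z : ℝ × ℝ, Real.exp (-(Real.pi * (a₂ * a₃ / (1 - a₁))) * (z.1 + z.2) ^ 2) ^ (1 - a₁) *
      Real.exp (-(Real.pi * (a₁ * a₃ / (1 - a₂))) * z.2 ^ 2) ^ (1 - a₂) *
      Real.exp (-(Real.pi * (a₁ * a₂ / (1 - a₃))) * z.1 ^ 2) ^ (1 - a₃) =
      Real.exp (-Real.pi * ((a₂ * a₃ + a₁ * a₂) * z.1 ^ 2 + 2 * (a₂ * a₃) * z.1 * z.2 +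
        (a₂ * a₃ + a₁ * a₃) * z.2 ^ 2)) := by
    intro z
    rw [← Real.exp_mul, ← Real.exp_mul, ← Real.exp_mul, ← Real.exp_add, ← Real.exp_add]
    congr 1
    field_simp
    ring
  have hdisc : (a₂ * a₃ + a₁ * a₂) * (a₂ * a₃ + a₁ * a₃) - (a₂ * a₃) ^ 2 = a₁ * a₂ * a₃ := by
    obtain rfl : a₃ = 1 - a₁ - a₂ := by linarith
    ring
  simp_rw [e] at h
  rw [lintegral_gaussian_prod (by positivity) (by rw [hdisc]; positivity), hdisc,
    ENNReal.ofReal_le_ofReal_iff', ← gaussianConstant_mul_sqrt_prod h₁ h₂ h₃ hs] at h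
  have hK := gaussianConstant_pos h₁ h₂ h₃ hs
  have hQ : 0 < √((1 - a₁) / (a₂ * a₃)) ^ (1 - a₁) *
      √((1 - a₂) / (a₁ * a₃)) ^ (1 - a₂) * √((1 - a₃) / (a₁ * a₂)) ^ (1 - a₃) := by positivity
  rcases h with h | h
  · exact le_of_mul_le_mul_right h hQ
  · exact absurd h (not_le.2 (mul_pos hK hQ))

/-! ### The Brascamp-Lieb datum and the matrix condition -/

theorem youngDatum_inequality_iff (c : Fin 3 → ℝ) (hc : ∀ i, 0 < c i) (C : ℝ) :
    (youngDatum c hc).Inequality C ↔ TrilinearInequality (c 0) (c 1) (c 2) C := by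
  have hU := volume_preserving_funUnique (Fin 1) ℝ
  have hV := volume_preserving_finTwoArrow ℝ
  have hUe := (MeasurableEquiv.funUnique (Fin 1) ℝ).measurableEmbedding
  have hVe := (MeasurableEquiv.finTwoArrow (α := ℝ)).measurableEmbedding
  have hB : ∀ (i : Fin 3) (x : Fin 2 → ℝ), youngMap i *ᵥ x =
      fun _ => ![x 0 + x 1, x 1, x 0] i := by
    intro i x
    ext j
    fin_cases i <;> fin_cases j <;> simp [youngMap, Matrix.mulVec, dotProduct, Fin.sum_univ_two]
  have key : ∀ f : Fin 3 → ℝ → ℝ,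
      (∫⁻ x : Fin 2 → ℝ, ENNReal.ofReal
        (∏ i, (f i ∘ MeasurableEquiv.funUnique (Fin 1) ℝ) (youngMap i *ᵥ x) ^ c i) =
      ∫⁻ z : ℝ × ℝ, ENNReal.ofReal
        (f 0 (z.1 + z.2) ^ c 0 * f 1 z.2 ^ c 1 * f 2 z.1 ^ c 2)) ∧
      (∏ i, (∫ y, (f i ∘ MeasurableEquiv.funUnique (Fin 1) ℝ) y) ^ c i =
        (∫ x, f 0 x) ^ c 0 * (∫ x, f 1 x) ^ c 1 * (∫ x, f 2 x) ^ c 2) := by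
    intro f
    constructor
    · rw [← hV.lintegral_comp_emb hVe]
      refine lintegral_congr fun x => ?_
      rw [Fin.prod_univ_three]
      simp only [hB, Function.comp]
      rfl
    · rw [Fin.prod_univ_three]
      congr 1; congr 1
      all_goals exact congrArg (· ^ _) (hU.integral_comp hUe _)
  constructor
  · intro H f g h hf0 hg0 hh0 hfi hgi hhi
    have h0 : ∀ i x, 0 ≤ (![f, g, h] : Fin 3 → ℝ → ℝ) i x := by
      intro i; fin_cases i
      exacts [hf0, hg0, hh0]
    have hi : ∀ i, Integrable ((![f, g, h] : Fin 3 → ℝ → ℝ) i) := by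
      intro i; fin_cases i
      exacts [hfi, hgi, hhi]
    have := H (fun i => (![f, g, h] : Fin 3 → ℝ → ℝ) i ∘ MeasurableEquiv.funUnique (Fin 1) ℝ)
      (fun i x => h0 i _) (fun i => (hU.integrable_comp_emb hUe).2 (hi i))
    exact ((key ![f, g, h]).1.symm.le.trans this).trans_eq
      (congrArg (fun t => ENNReal.ofReal (C * t)) (key ![f, g, h]).2)
  · intro H f hf0 hfi
    set f' : Fin 3 → ℝ → ℝ := fun i u => f i (fun _ => u) with hf'
    have ef : ∀ i, f i = f' i ∘ MeasurableEquiv.funUnique (Fin 1) ℝ := by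
      intro i
      ext x
      refine congrArg (f i) ?_
      ext j
      obtain rfl : j = (0 : Fin 1) := Subsingleton.elim (α := Fin 1) _ _
      rfl
    have hi : ∀ i, Integrable (f' i) := fun i => by
      have := hfi i
      rw [ef i] at this
      exact (hU.integrable_comp_emb hUe).1 this
    have := H (f' 0) (f' 1) (f' 2) (fun x => hf0 0 _) (fun x => hf0 1 _) (fun x => hf0 2 _)
      (hi 0) (hi 1) (hi 2)
    rw [← (key f').1, ← (key f').2] at this
    simp_rw [ef]
    exact this

theorem posDef_fin_two_iff {x y z : ℝ} :
    !![x, z; z, y].PosDef ↔ 0 < x ∧ 0 < x * y - z ^ 2 := by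
  constructor
  · intro h
    have h0 := h.diag_pos (i := 0)
    have h1 := h.det_pos
    rw [Matrix.det_fin_two_of] at h1
    exact ⟨by simpa using h0, by linarith [h1, sq z]⟩
  · rintro ⟨hx, hD⟩
    refine Matrix.PosDef.of_dotProduct_mulVec_pos ?_ ?_
    · ext i j; fin_cases i <;> fin_cases j <;> simp
    · intro v hv
      have e : star v ⬝ᵥ (!![x, z; z, y] *ᵥ v) =
          ((x * v 0 + z * v 1) ^ 2 + (x * y - z ^ 2) * v 1 ^ 2) / x := by
        simp [Matrix.mulVec, dotProduct, Fin.sum_univ_two]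
        field_simp
        ring
      rw [e]
      refine div_pos ?_ hx
      by_cases h1 : v 1 = 0
      · have h0 : v 0 ≠ 0 := fun h0 => hv (by ext i; fin_cases i <;> simp [h0, h1])
        rw [h1]
        have : 0 < (x * v 0) ^ 2 := by positivity
        simpa using this
      · have : 0 < (x * y - z ^ 2) * v 1 ^ 2 := by positivity
        nlinarith [sq_nonneg (x * v 0 + z * v 1)]

theorem youngMap_mul_mul_transpose (x y z : ℝ) (i : Fin 3) :
    youngMap i * !![x, z; z, y] * (youngMap i)ᵀ = !![![x + y + 2 * z, y, x] i] := by
  ext a b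
  fin_cases a
  fin_cases b
  fin_cases i <;> simp [youngMap, Matrix.mul_apply, Fin.sum_univ_two]
  ring

theorem youngDatum_matrixCondition_iff (c : Fin 3 → ℝ) (hc : ∀ i, 0 < c i) (x y z : ℝ)
    (hA : !![x, z; z, y].PosDef) :
    (youngDatum c hc).MatrixCondition !![x, z; z, y] ↔
      (1 - c 1) * (x * y) + y * z + c 1 * z ^ 2 = 0 ∧
      (1 - c 2) * (x * y) + x * z + c 2 * z ^ 2 = 0 ∧
      c 0 + c 1 + c 2 = 2 := by
  obtain ⟨hx, hD⟩ := posDef_fin_two_iff.1 hA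
  have hy : 0 < y := by
    by_contra h
    nlinarith [mul_nonneg hx.le (not_lt.1 h |> neg_nonneg.2), sq_nonneg z]
  have hs : 0 < x + y + 2 * z := by
    by_contra h
    nlinarith [sq_nonneg (x - y)]
  have hinv : (!![x, z; z, y] : Matrix (Fin 2) (Fin 2) ℝ)⁻¹ =
      !![y / (x * y - z ^ 2), -z / (x * y - z ^ 2); -z / (x * y - z ^ 2), x / (x * y - z ^ 2)] := by
    rw [Matrix.inv_def, Matrix.det_fin_two_of, Matrix.adjugate_fin_two_of, Ring.inverse_eq_inv',
      ← sq]
    ext i j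
    fin_cases i <;> fin_cases j <;> simp [div_eq_inv_mul]
  have hone : ∀ s : ℝ, (!![s] : Matrix (Fin 1) (Fin 1) ℝ)⁻¹ = !![s⁻¹] := by
    intro s
    rw [Matrix.inv_def, Matrix.adjugate_subsingleton, Matrix.det_fin_one, Ring.inverse_eq_inv']
    ext i j
    fin_cases i
    fin_cases j
    simp
  have hsum : ∑ i, c i • ((youngMap i)ᵀ * (youngMap i * !![x, z; z, y] * (youngMap i)ᵀ)⁻¹ *
      youngMap i) = !![c 0 / (x + y + 2 * z) + c 2 / x, c 0 / (x + y + 2 * z);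
        c 0 / (x + y + 2 * z), c 0 / (x + y + 2 * z) + c 1 / y] := by
    simp_rw [youngMap_mul_mul_transpose, hone]
    rw [Fin.sum_univ_three]
    ext i j
    fin_cases i <;> fin_cases j <;>
      simp [youngMap, Matrix.mul_apply, div_eq_mul_inv]
  change (!![x, z; z, y] : Matrix (Fin 2) (Fin 2) ℝ)⁻¹ = ∑ i, c i • ((youngMap i)ᵀ *
    (youngMap i * !![x, z; z, y] * (youngMap i)ᵀ)⁻¹ * youngMap i) ↔ _
  rw [hinv, hsum, ← Matrix.ext_iff]
  simp only [Fin.forall_fin_two, Matrix.of_apply, Matrix.cons_val_zero, Matrix.cons_val_one]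
  constructor
  · rintro ⟨⟨e₁, e₂⟩, -, e₃⟩
    rw [← e₂] at e₁ e₃
    have f₁ : x * (y + z) = c 2 * (x * y - z ^ 2) := by
      generalize x * y - z ^ 2 = D at *
      field_simp at e₁
      linarith
    have f₂ : y * (x + z) = c 1 * (x * y - z ^ 2) := by
      generalize x * y - z ^ 2 = D at *
      field_simp at e₃
      linarith
    have f₃ : -z * (x + y + 2 * z) = c 0 * (x * y - z ^ 2) :=
      (div_eq_div_iff hD.ne' hs.ne').1 e₂
    refine ⟨by linarith, by linarith, ?_⟩
    -- The left-hand sides of `f₁`, `f₂`, `f₃` add up to 2(xy - z²).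
    have : (c 0 + c 1 + c 2 - 2) * (x * y - z ^ 2) = 0 := by linarith
    rcases mul_eq_zero.1 this with h | h <;> linarith
  · rintro ⟨e₁, e₂, e₃⟩
    have g₁ : c 1 = y * (x + z) / (x * y - z ^ 2) := by
      rw [eq_div_iff hD.ne']; linarith
    have g₂ : c 2 = x * (y + z) / (x * y - z ^ 2) := by
      rw [eq_div_iff hD.ne']; linarith
    have g₀ : c 0 / (x + y + 2 * z) = -z / (x * y - z ^ 2) := by
      rw [div_eq_div_iff hs.ne' hD.ne']
      linear_combination (x * y - z ^ 2) * e₃ + e₁ + e₂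
    rw [g₀, g₁, g₂]
    refine ⟨⟨?_, rfl⟩, rfl, ?_⟩ <;> field_simp <;> ring

theorem matrixCondition_solutions {c₂ c₃ : ℝ} (h₂ : c₂ < 1) (h₃ : c₃ < 1) {x y z : ℝ} (hz : z ≠ 0) :
    ((1 - c₂) * (x * y) + y * z + c₂ * z ^ 2 = 0 ∧
      (1 - c₃) * (x * y) + x * z + c₃ * z ^ 2 = 0 ↔
      (∃ t : ℝ, x = t ∧ y = t ∧ z = -t) ∨
      (∃ t : ℝ, x = t * (c₃ * (1 - c₃)) ∧ y = t * (c₂ * (1 - c₂)) ∧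
        z = -(t * ((1 - c₂) * (1 - c₃))))) := by
  constructor
  · rintro ⟨e₁, e₂⟩
    have hp : 0 < (1 - c₂) * (1 - c₃) := mul_pos (by linarith) (by linarith)
    -- This combination eliminates xy; dividing by z leaves a linear relation that determines y.
    -- Substituted into the second equation, it gives a product of two linear forms in x and z.
    have f : ((1 - c₃) * y - (1 - c₂) * x - (c₂ - c₃) * -z) * z = 0 := by
      linear_combination (1 - c₃) * e₁ - (1 - c₂) * e₂
    have f' := (mul_eq_zero.1 f).resolve_right hz
    have g : (x + z) * ((1 - c₂) * x + c₃ * z) = 0 := by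
      have h3 : (1 - c₃) * ((x + z) * ((1 - c₂) * x + c₃ * z)) = 0 := by
        linear_combination (1 - c₃) * e₂ - (1 - c₃) * x * f'
      exact (mul_eq_zero.1 h3).resolve_left (by linarith)
    rcases mul_eq_zero.1 g with g | g
    · left
      refine ⟨x, rfl, ?_, by linarith⟩
      have : (1 - c₃) * (y - x) = 0 := by linear_combination f' - (c₂ - c₃) * g
      linarith [(mul_eq_zero.1 this).resolve_left (by linarith)]
    · right
      refine ⟨-z / ((1 - c₂) * (1 - c₃)), ?_, ?_, ?_⟩
      · have h2 : (1 - c₂) ≠ 0 := by linarith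
        have h3 : (1 - c₃) ≠ 0 := by linarith
        field_simp
        linarith
      · have h2 : (1 - c₂) ≠ 0 := by linarith
        have h3 : (1 - c₃) ≠ 0 := by linarith
        field_simp
        linarith
      · rw [div_mul_cancel₀ _ hp.ne', neg_neg]
  · rintro (⟨t, rfl, rfl, rfl⟩ | ⟨t, rfl, rfl, rfl⟩) <;> constructor <;> ring

/-! ### Duality between Young's inequality and the trilinear inequality -/

theorem aemeasurable_trilinear_integrand {f g h : ℝ → ℝ} (hf : AEMeasurable f)
    (hg : AEMeasurable g) (hh : AEMeasurable h) (c₁ c₂ c₃ : ℝ) :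
    AEMeasurable fun z : ℝ × ℝ =>
      ENNReal.ofReal (f (z.1 + z.2) ^ c₁ * g z.2 ^ c₂ * h z.1 ^ c₃) := by
  have m₁ : AEMeasurable fun z : ℝ × ℝ => f (z.1 + z.2) :=
    hf.comp_quasiMeasurePreserving quasiMeasurePreserving_add_prod
  have m₂ : AEMeasurable fun z : ℝ × ℝ => g z.2 :=
    hg.comp_quasiMeasurePreserving Measure.quasiMeasurePreserving_snd
  have m₃ : AEMeasurable fun z : ℝ × ℝ => h z.1 :=
    hh.comp_quasiMeasurePreserving Measure.quasiMeasurePreserving_fst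
  exact (((m₁.pow_const _).mul (m₂.pow_const _)).mul (m₃.pow_const _)).ennreal_ofReal

/-- Tonelli and the translation t = x + y: the form becomes a convolution paired with a power of h.
-/
theorem lintegral_trilinear_eq {f g h : ℝ → ℝ} (hf0 : ∀ x, 0 ≤ f x) (hg0 : ∀ x, 0 ≤ g x)
    (hf : AEMeasurable f) (hg : AEMeasurable g) (hh : AEMeasurable h) (c₁ c₂ c₃ : ℝ) :
    ∫⁻ z : ℝ × ℝ, ENNReal.ofReal (f (z.1 + z.2) ^ c₁ * g z.2 ^ c₂ * h z.1 ^ c₃) =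
      ∫⁻ x, (∫⁻ t, ENNReal.ofReal (f t ^ c₁) * ENNReal.ofReal (g (t - x) ^ c₂)) *
        ENNReal.ofReal (h x ^ c₃) := by
  rw [Measure.volume_eq_prod, lintegral_prod _ (aemeasurable_trilinear_integrand hf hg hh _ _ _)]
  refine lintegral_congr fun x => ?_
  rw [← lintegral_mul_const' _ _ ENNReal.ofReal_ne_top, 
    ← lintegral_add_left_eq_self (fun t => ENNReal.ofReal (f t ^ c₁) *
      ENNReal.ofReal (g (t - x) ^ c₂) * ENNReal.ofReal (h x ^ c₃)) x]
  refine lintegral_congr fun y => ?_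
  rw [add_sub_cancel_left, ENNReal.ofReal_mul (by have := hf0 (x + y); have := hg0 y; positivity),
    ENNReal.ofReal_mul (by have := hf0 (x + y); positivity)]

/-- Duality: if `∫ u h^{1-1/r} ≤ A (∫ h)^{1-1/r}` for all integrable `h ≥ 0`, then
`∫ u^r ≤ A^r`. -/
theorem lintegral_rpow_le_of_dual {u : ℝ → ENNReal} (hu : AEMeasurable u) {A : ENNReal}
    {r : ℝ} (hr : 1 < r)
    (H : ∀ h : ℝ → ℝ, (∀ x, 0 ≤ h x) → Integrable h →
      ∫⁻ x, u x * ENNReal.ofReal (h x ^ (1 - 1 / r)) ≤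
        A * ENNReal.ofReal ((∫ x, h x) ^ (1 - 1 / r))) :
    ∫⁻ x, u x ^ r ≤ A ^ r := by
  have hr0 : 0 < r := by linarith
  have hc : 0 < 1 - 1 / r := by
    rw [sub_pos, div_lt_one hr0]; exact hr
  -- Truncating in height and support makes ∫ v_n^r finite, so that a power of it can be cancelled
  -- below. Monotone convergence recovers u.
  set v : ℕ → ℝ → ENNReal := fun n =>
    (Set.Icc (-(n : ℝ)) n).indicator fun x => min (u x) n with hv
  have hvm : ∀ n, AEMeasurable (v n) := fun n =>
    (hu.min aemeasurable_const).indicator measurableSet_Icc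
  have hvu : ∀ n x, v n x ≤ u x := fun n x => by
    by_cases hx : x ∈ Set.Icc (-(n : ℝ)) n
    · simp only [hv, Set.indicator_of_mem hx]; exact min_le_left _ _
    · simp only [hv, Set.indicator_of_notMem hx]; exact zero_le
  have hvn : ∀ n x, v n x ≤ n := fun n x => by
    by_cases hx : x ∈ Set.Icc (-(n : ℝ)) n
    · simp only [hv, Set.indicator_of_mem hx]; exact min_le_right _ _
    · simp only [hv, Set.indicator_of_notMem hx]; exact zero_le
  have hvtop : ∀ n x, v n x ≠ ⊤ := fun n x =>
    ((hvn n x).trans_lt (ENNReal.natCast_lt_top n)).ne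
  have hmono : Monotone v := by
    intro m n hmn x
    have hmn' : (m : ℝ) ≤ n := by exact_mod_cast hmn
    by_cases hx : x ∈ Set.Icc (-(m : ℝ)) m
    · have hx' : x ∈ Set.Icc (-(n : ℝ)) n := ⟨by linarith [hx.1], by linarith [hx.2]⟩
      simp only [hv, Set.indicator_of_mem hx, Set.indicator_of_mem hx']
      exact min_le_min_left _ (by exact_mod_cast hmn)
    · simp only [hv, Set.indicator_of_notMem hx]; exact zero_le
  have hsup : ∀ x, ⨆ n, v n x = u x := by
    intro x
    refine le_antisymm (iSup_le fun n => hvu n x) (le_of_forall_lt fun b hb => ?_)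
    obtain ⟨N₁, hN₁⟩ := exists_nat_ge |x|
    obtain ⟨N₂, hN₂⟩ := ENNReal.exists_nat_gt hb.ne_top
    refine lt_of_lt_of_le ?_ (le_iSup _ (max N₁ N₂))
    have hx : x ∈ Set.Icc (-((max N₁ N₂ : ℕ) : ℝ)) (max N₁ N₂ : ℕ) := by
      exact abs_le.1 (hN₁.trans (by exact_mod_cast le_max_left _ _))
    simp only [hv, Set.indicator_of_mem hx]
    exact lt_min hb (hN₂.trans_le (by exact_mod_cast le_max_right _ _))
  have hbound : ∀ n, ∫⁻ x, v n x ^ r ≤ A ^ r := by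
    intro n
    have hfin : ∫⁻ x, v n x ^ r ≠ ⊤ := by
      have h1 : ∫⁻ x, v n x ^ r ≤
          ∫⁻ x, (Set.Icc (-(n : ℝ)) n).indicator (fun _ => (n : ENNReal) ^ r) x := by
        refine lintegral_mono fun x => ?_
        by_cases hx : x ∈ Set.Icc (-(n : ℝ)) n
        · rw [Set.indicator_of_mem hx]
          exact ENNReal.rpow_le_rpow (hvn n x) hr0.le
        · simp only [hv, Set.indicator_of_notMem hx]
          rw [ENNReal.zero_rpow_of_pos hr0]
      refine ne_top_of_le_ne_top ?_ h1
      rw [lintegral_indicator measurableSet_Icc, setLIntegral_const, Real.volume_Icc]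
      exact ENNReal.mul_ne_top
        (ENNReal.rpow_ne_top_of_nonneg hr0.le (ENNReal.natCast_ne_top n)) ENNReal.ofReal_ne_top
    have hrt : ∀ x, v n x ^ r ≠ ⊤ := fun x => ENNReal.rpow_ne_top_of_nonneg hr0.le (hvtop n x)
    have hmeas : AEMeasurable fun x => v n x ^ r := (hvm n).pow_const _
    -- The extremal test function h = v_n^r of L_r duality: h^{1-1/r} = v_n^{r-1}, and v_n^r ≤ u
    -- v_n^{r-1}.
    have key := H (fun x => (v n x ^ r).toReal) (fun x => ENNReal.toReal_nonneg)
      (integrable_toReal_of_lintegral_ne_top hmeas hfin)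
    rw [integral_toReal hmeas (Filter.Eventually.of_forall fun x => (hrt x).lt_top),
      ← ENNReal.ofReal_rpow_of_nonneg ENNReal.toReal_nonneg hc.le, ENNReal.ofReal_toReal hfin] at key
    have hle : ∫⁻ x, v n x ^ r ≤ A * (∫⁻ x, v n x ^ r) ^ (1 - 1 / r) := by
      refine le_trans (lintegral_mono fun x => ?_) key
      rw [← ENNReal.ofReal_rpow_of_nonneg ENNReal.toReal_nonneg hc.le,
        ENNReal.ofReal_toReal (hrt x), ← ENNReal.rpow_mul,
        show r * (1 - 1 / r) = r - 1 by field_simp]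
      calc v n x ^ r = v n x ^ (1 + (r - 1)) := by ring_nf
        _ = v n x ^ (1 : ℝ) * v n x ^ (r - 1) :=
          ENNReal.rpow_add_of_nonneg _ _ zero_le_one (by linarith)
        _ ≤ u x * v n x ^ (r - 1) := by
          rw [ENNReal.rpow_one]
          gcongr
          exact hvu n x
    set I := ∫⁻ x, v n x ^ r with hI
    by_cases hI0 : I = 0
    · rw [hI0]; exact zero_le
    have hsplit : I = I ^ (1 / r) * I ^ (1 - 1 / r) := by
      rw [← ENNReal.rpow_add _ _ hI0 hfin, add_sub_cancel, ENNReal.rpow_one]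
    have hne0 : I ^ (1 - 1 / r) ≠ 0 := by
      simp [ENNReal.rpow_eq_zero_iff, hI0, hfin]
    have hnet : I ^ (1 - 1 / r) ≠ ⊤ := ENNReal.rpow_ne_top_of_nonneg hc.le hfin
    have h2 : I ^ (1 / r) ≤ A := by
      rw [← ENNReal.mul_le_mul_iff_left hne0 hnet, ← hsplit]
      exact hle
    calc I = (I ^ (1 / r)) ^ r := by
          rw [← ENNReal.rpow_mul, one_div_mul_cancel hr0.ne', ENNReal.rpow_one]
      _ ≤ A ^ r := ENNReal.rpow_le_rpow h2 hr0.le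
  calc ∫⁻ x, u x ^ r = ∫⁻ x, ⨆ n, v n x ^ r := by
        refine lintegral_congr fun x => ?_
        rw [← hsup x]
        exact (ENNReal.orderIsoRpow r hr0).map_iSup _
    _ = ⨆ n, ∫⁻ x, v n x ^ r := by
        refine lintegral_iSup' (fun n => (hvm n).pow_const _) (Filter.Eventually.of_forall ?_)
        intro x m n hmn
        exact ENNReal.rpow_le_rpow (hmono hmn x) hr0.le
    _ ≤ A ^ r := iSup_le hbound

section

variable {𝕜 : Type*} [RCLike 𝕜]

theorem enorm_ofReal_of_nonneg {a : ℝ} (ha : 0 ≤ a) : ‖(a : 𝕜)‖ₑ = ENNReal.ofReal a := by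
  rw [← ofReal_norm, RCLike.norm_ofReal, abs_of_nonneg ha]

theorem eLpNorm_eq_ofReal_integral {F : ℝ → 𝕜} {p : ℝ} (hp : 0 < p)
    (hF : MemLp F (ENNReal.ofReal p)) :
    eLpNorm F (ENNReal.ofReal p) volume = ENNReal.ofReal ((∫ x, ‖F x‖ ^ p) ^ (1 / p)) := by
  rw [hF.eLpNorm_eq_integral_rpow_norm (ENNReal.ofReal_pos.2 hp).ne' ENNReal.ofReal_ne_top,
    ENNReal.toReal_ofReal hp.le, one_div]

theorem integrable_norm_rpow_of_memLp {F : ℝ → 𝕜} {p : ℝ} (hp : 0 < p)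
    (hF : MemLp F (ENNReal.ofReal p)) : Integrable fun x => ‖F x‖ ^ p := by
  have := hF.integrable_norm_rpow (ENNReal.ofReal_pos.2 hp).ne' ENNReal.ofReal_ne_top
  rwa [ENNReal.toReal_ofReal hp.le] at this

theorem memLp_ofReal_rpow {f : ℝ → ℝ} (hf0 : ∀ x, 0 ≤ f x) (hf : Integrable f) {p : ℝ}
    (hp : 0 < p) :
    MemLp (fun x => ((f x ^ (1 / p) : ℝ) : 𝕜)) (ENNReal.ofReal p) ∧
      eLpNorm (fun x => ((f x ^ (1 / p) : ℝ) : 𝕜)) (ENNReal.ofReal p) volume =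
        ENNReal.ofReal ((∫ x, f x) ^ (1 / p)) := by
  have hm : AEStronglyMeasurable (fun x => ((f x ^ (1 / p) : ℝ) : 𝕜)) :=
    (RCLike.continuous_ofReal (K := 𝕜)).comp_aestronglyMeasurable
      (hf.1.aemeasurable.pow_const _).aestronglyMeasurable
  have hnorm : ∀ x, ‖((f x ^ (1 / p) : ℝ) : 𝕜)‖ ^ p = f x := fun x => by
    rw [RCLike.norm_ofReal, abs_of_nonneg (Real.rpow_nonneg (hf0 x) _), ← Real.rpow_mul (hf0 x),
      one_div_mul_cancel hp.ne', Real.rpow_one]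
  have hmem : MemLp (fun x => ((f x ^ (1 / p) : ℝ) : 𝕜)) (ENNReal.ofReal p) := by
    rw [← integrable_norm_rpow_iff hm (ENNReal.ofReal_pos.2 hp).ne' ENNReal.ofReal_ne_top,
      ENNReal.toReal_ofReal hp.le]
    simpa only [hnorm] using hf
  refine ⟨hmem, ?_⟩
  rw [eLpNorm_eq_ofReal_integral hp hmem]
  simp only [hnorm]

theorem aemeasurable_lintegral_enorm_mul {F G : ℝ → 𝕜} (hF : AEStronglyMeasurable F)
    (hG : AEStronglyMeasurable G) : AEMeasurable fun x => ∫⁻ t, ‖F t‖ₑ * ‖G (x - t)‖ₑ := by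
  have h : AEMeasurable (fun z : ℝ × ℝ => ‖F z.2‖ₑ * ‖G (z.1 - z.2)‖ₑ)
      (volume.prod volume) :=
    (hF.enorm.comp_quasiMeasurePreserving Measure.quasiMeasurePreserving_snd).mul
      (hG.enorm.comp_quasiMeasurePreserving (quasiMeasurePreserving_sub volume volume))
  exact h.lintegral_prod_right'

/-- Duality applied to |F| * |G|, with f = |F|^p and g(x) = |G(-x)|^q in the trilinear form.
Absolute values inside the integral yield existence of the convolution as well as the norm bound. -/
theorem lintegral_convolution_rpow_le {p q r C : ℝ} (hp : 0 < p) (hq : 0 < q) (hr : 1 < r)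
    (hC0 : 0 ≤ C) (hC : TrilinearInequality (1 / p) (1 / q) (1 - 1 / r) C) {F G : ℝ → 𝕜}
    (hF : MemLp F (ENNReal.ofReal p)) (hG : MemLp G (ENNReal.ofReal q)) :
    ∫⁻ x, (∫⁻ t, ‖F t‖ₑ * ‖G (x - t)‖ₑ) ^ r ≤
      (ENNReal.ofReal C * eLpNorm F (ENNReal.ofReal p) volume *
        eLpNorm G (ENNReal.ofReal q) volume) ^ r := by
  refine lintegral_rpow_le_of_dual (aemeasurable_lintegral_enorm_mul hF.1 hG.1) hr ?_
  intro h hh0 hhi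
  have hFi := integrable_norm_rpow_of_memLp hp hF
  have hGi := (integrable_norm_rpow_of_memLp hq hG).comp_neg
  have hf0 : ∀ x, 0 ≤ ‖F x‖ ^ p := fun x => by positivity
  have hg0 : ∀ x, 0 ≤ ‖G (-x)‖ ^ q := fun x => by positivity
  have key := hC _ _ h hf0 hg0 hh0 hFi hGi hhi
  rw [lintegral_trilinear_eq hf0 hg0 hFi.1.aemeasurable hGi.1.aemeasurable hhi.1.aemeasurable,
    integral_neg_eq_self (fun x => ‖G x‖ ^ q) volume] at key
  have e₁ : ∀ t, ENNReal.ofReal ((‖F t‖ ^ p) ^ (1 / p)) = ‖F t‖ₑ := fun t => by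
    rw [← Real.rpow_mul (norm_nonneg _), mul_one_div_cancel hp.ne', Real.rpow_one,
      ofReal_norm]
  have e₂ : ∀ x t, ENNReal.ofReal ((‖G (-(t - x))‖ ^ q) ^ (1 / q)) = ‖G (x - t)‖ₑ := fun x t => by
    rw [← Real.rpow_mul (norm_nonneg _), mul_one_div_cancel hq.ne', Real.rpow_one,
      ofReal_norm, neg_sub]
  simp_rw [e₁, e₂] at key
  refine key.trans (le_of_eq ?_)
  rw [eLpNorm_eq_ofReal_integral hp hF, eLpNorm_eq_ofReal_integral hq hG,
    ← ENNReal.ofReal_mul hC0,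
    ← ENNReal.ofReal_mul (mul_nonneg hC0 (Real.rpow_nonneg (integral_nonneg hf0) _)),
    ← ENNReal.ofReal_mul (mul_nonneg (mul_nonneg hC0 (Real.rpow_nonneg (integral_nonneg hf0) _))
      (Real.rpow_nonneg (integral_nonneg fun x => by positivity) _))]
  congr 1
  ring

theorem ae_convolutionExistsAt {p q r C : ℝ} (hp : 0 < p) (hq : 0 < q) (hr : 1 < r)
    (hC0 : 0 ≤ C) (hC : TrilinearInequality (1 / p) (1 / q) (1 - 1 / r) C) {F G : ℝ → 𝕜}
    (hF : MemLp F (ENNReal.ofReal p)) (hG : MemLp G (ENNReal.ofReal q)) :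
    ∀ᵐ x : ℝ, ConvolutionExistsAt F G x (ContinuousLinearMap.mul 𝕜 𝕜) volume := by
  have hr0 : 0 < r := by linarith
  have h := lintegral_convolution_rpow_le hp hq hr hC0 hC hF hG
  have hfin : ∫⁻ x, (∫⁻ t, ‖F t‖ₑ * ‖G (x - t)‖ₑ) ^ r ≠ ⊤ :=
    ne_top_of_le_ne_top (ENNReal.rpow_ne_top_of_nonneg hr0.le
      (ENNReal.mul_ne_top (ENNReal.mul_ne_top ENNReal.ofReal_ne_top hF.2.ne) hG.2.ne)) h
  filter_upwards [ae_lt_top' ((aemeasurable_lintegral_enorm_mul hF.1 hG.1).pow_const r) hfin]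
    with x hx
  refine ⟨hF.1.convolution_integrand_snd _ hG.1 x, ?_⟩
  rw [hasFiniteIntegral_iff_enorm]
  simp only [ContinuousLinearMap.mul_apply', enorm_mul]
  exact (ENNReal.rpow_lt_top_iff_of_pos hr0).1 hx

theorem youngInequality_of_trilinearInequality {p q r C : ℝ} (hp : 0 < p) (hq : 0 < q)
    (hr : 1 < r) (hC0 : 0 ≤ C) (hC : TrilinearInequality (1 / p) (1 / q) (1 - 1 / r) C) :
    YoungInequality 𝕜 p q r C := by
  intro F G hF hG
  have hr0 : 0 < r := by linarith
  rw [eLpNorm_eq_lintegral_rpow_enorm_toReal (ENNReal.ofReal_pos.2 hr0).ne' ENNReal.ofReal_ne_top,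
    ENNReal.toReal_ofReal hr0.le, one_div, ENNReal.rpow_inv_le_iff hr0]
  refine le_trans (lintegral_mono fun x => ?_)
    (lintegral_convolution_rpow_le hp hq hr hC0 hC hF hG)
  refine ENNReal.rpow_le_rpow ((enorm_integral_le_lintegral_enorm _).trans (le_of_eq ?_)) hr0.le
  simp only [ContinuousLinearMap.mul_apply', enorm_mul]

theorem memLp_lineConvolution {p q r C : ℝ} (hp : 0 < p) (hq : 0 < q)
    (hr : 1 < r) (hC0 : 0 ≤ C) (hC : TrilinearInequality (1 / p) (1 / q) (1 - 1 / r) C)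
    {F G : ℝ → 𝕜} (hF : MemLp F (ENNReal.ofReal p)) (hG : MemLp G (ENNReal.ofReal q)) :
    MemLp (lineConvolution F G) (ENNReal.ofReal r) :=
  ⟨(hF.1.convolution_integrand (ContinuousLinearMap.mul 𝕜 𝕜) hG.1).integral_prod_right',
    (youngInequality_of_trilinearInequality hp hq hr hC0 hC F G hF hG).trans_lt
      (ENNReal.mul_lt_top (ENNReal.mul_lt_top ENNReal.ofReal_lt_top hF.2) hG.2)⟩

/-- Hölder applied to the convolution of f^{1/p} with the reflected g^{1/q}, paired with h^{1-1/r}.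
The auxiliary K only supplies integrability, so that C may be arbitrary. -/
theorem trilinearInequality_of_youngInequality {p q r C K : ℝ} (hp : 0 < p) (hq : 0 < q)
    (hr : 1 < r) (hK0 : 0 ≤ K) (hK : TrilinearInequality (1 / p) (1 / q) (1 - 1 / r) K)
    (hC : YoungInequality 𝕜 p q r C) : TrilinearInequality (1 / p) (1 / q) (1 - 1 / r) C := by
  intro f g h hf0 hg0 hh0 hfi hgi hhi
  have hr0 : 0 < r := by linarith
  have hc : 0 < 1 - 1 / r := by
    rw [sub_pos, div_lt_one hr0]; exact hr
  have hg0' : ∀ x, 0 ≤ g (-x) := fun x => hg0 _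
  obtain ⟨hF, eF⟩ := memLp_ofReal_rpow (𝕜 := 𝕜) hf0 hfi hp
  obtain ⟨hG, eG⟩ := memLp_ofReal_rpow (𝕜 := 𝕜) hg0' hgi.comp_neg hq
  rw [integral_neg_eq_self g volume] at eG
  have young := hC _ _ hF hG
  -- Where the convolution integral diverges its value defaults to 0, and a norm bound would say
  -- nothing about the form; this is excluded almost everywhere.
  have hex := ae_convolutionExistsAt hp hq hr hK0 hK hF hG
  have hmem := memLp_lineConvolution hp hq hr hK0 hK hF hG
  rw [eF, eG] at young
  set F : ℝ → 𝕜 := fun x => ((f x ^ (1 / p) : ℝ) : 𝕜) with hFdef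
  set G : ℝ → 𝕜 := fun x => ((g (-x) ^ (1 / q) : ℝ) : 𝕜) with hGdef
  have hconv : ∀ᵐ x : ℝ, ∫⁻ t, ENNReal.ofReal (f t ^ (1 / p)) *
      ENNReal.ofReal (g (t - x) ^ (1 / q)) = ‖lineConvolution F G x‖ₑ := by
    filter_upwards [hex] with x hx
    set φ : ℝ → ℝ := fun t => f t ^ (1 / p) * g (t - x) ^ (1 / q) with hφ
    have hφ0 : ∀ t, 0 ≤ φ t := fun t =>
      mul_nonneg (Real.rpow_nonneg (hf0 _) _) (Real.rpow_nonneg (hg0 _) _)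
    have e : ∀ t, ContinuousLinearMap.mul 𝕜 𝕜 (F t) (G (x - t)) = ((φ t : ℝ) : 𝕜) := fun t => by
      simp only [ContinuousLinearMap.mul_apply', hFdef, hGdef, hφ, neg_sub, RCLike.ofReal_mul]
    have hint : Integrable φ := by
      have h1 : Integrable fun t => ((φ t : ℝ) : 𝕜) := by
        have := hx.integrable
        simpa only [e] using this
      have h2 := h1.norm
      simpa only [RCLike.norm_ofReal, abs_of_nonneg (hφ0 _)] using h2
    have e2 : lineConvolution F G x = ((∫ t, φ t : ℝ) : 𝕜) := by
      rw [lineConvolution, convolution_def]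
      simp only [e]
      exact integral_ofReal
    rw [e2, enorm_ofReal_of_nonneg (integral_nonneg hφ0),
      ofReal_integral_eq_lintegral_ofReal hint (ae_of_all _ hφ0)]
    refine lintegral_congr fun t => ?_
    rw [← ENNReal.ofReal_mul (Real.rpow_nonneg (hf0 _) _)]
  have hrr : r.HolderConjugate (1 - 1 / r)⁻¹ := by
    rw [Real.holderConjugate_iff]
    refine ⟨hr, ?_⟩
    rw [inv_inv]; ring
  have hh : (∫⁻ x, ENNReal.ofReal (h x ^ (1 - 1 / r)) ^ (1 - 1 / r)⁻¹) ^ (1 / (1 - 1 / r)⁻¹) =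
      ENNReal.ofReal ((∫ x, h x) ^ (1 - 1 / r)) := by
    have e : ∀ x, ENNReal.ofReal (h x ^ (1 - 1 / r)) ^ (1 - 1 / r)⁻¹ = ENNReal.ofReal (h x) := by
      intro x
      rw [ENNReal.ofReal_rpow_of_nonneg (Real.rpow_nonneg (hh0 x) _) (inv_nonneg.2 hc.le),
        ← Real.rpow_mul (hh0 x), mul_inv_cancel₀ hc.ne', Real.rpow_one]
    simp_rw [e]
    rw [← ofReal_integral_eq_lintegral_ofReal hhi (ae_of_all _ hh0), one_div, inv_inv,
      ENNReal.ofReal_rpow_of_nonneg (integral_nonneg hh0) hc.le]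
  rw [lintegral_trilinear_eq hf0 hg0 hfi.1.aemeasurable hgi.1.aemeasurable hhi.1.aemeasurable]
  calc ∫⁻ x, (∫⁻ t, ENNReal.ofReal (f t ^ (1 / p)) * ENNReal.ofReal (g (t - x) ^ (1 / q))) *
        ENNReal.ofReal (h x ^ (1 - 1 / r))
      = ∫⁻ x, ‖lineConvolution F G x‖ₑ * ENNReal.ofReal (h x ^ (1 - 1 / r)) := by
        refine lintegral_congr_ae ?_
        filter_upwards [hconv] with x hx
        rw [hx]
    _ ≤ (∫⁻ x, ‖lineConvolution F G x‖ₑ ^ r) ^ (1 / r) *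
        (∫⁻ x, ENNReal.ofReal (h x ^ (1 - 1 / r)) ^ (1 - 1 / r)⁻¹) ^ (1 / (1 - 1 / r)⁻¹) :=
        ENNReal.lintegral_mul_le_Lp_mul_Lq volume hrr hmem.1.enorm
          (hhi.1.aemeasurable.pow_const _).ennreal_ofReal
    _ = eLpNorm (lineConvolution F G) (ENNReal.ofReal r) volume *
        ENNReal.ofReal ((∫ x, h x) ^ (1 - 1 / r)) := by
        rw [hh, eLpNorm_eq_lintegral_rpow_enorm_toReal (ENNReal.ofReal_pos.2 hr0).ne'
          ENNReal.ofReal_ne_top, ENNReal.toReal_ofReal hr0.le]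
    _ ≤ ENNReal.ofReal C * ENNReal.ofReal ((∫ x, f x) ^ (1 / p)) *
        ENNReal.ofReal ((∫ x, g x) ^ (1 / q)) * ENNReal.ofReal ((∫ x, h x) ^ (1 - 1 / r)) := by
        gcongr
    _ = ENNReal.ofReal
        (C * ((∫ x, f x) ^ (1 / p) * (∫ x, g x) ^ (1 / q) * (∫ x, h x) ^ (1 - 1 / r))) := by
        have i₁ := Real.rpow_nonneg (integral_nonneg hf0 : 0 ≤ ∫ x, f x) (1 / p)
        have i₂ := Real.rpow_nonneg (integral_nonneg hg0 : 0 ≤ ∫ x, g x) (1 / q)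
        have i₃ := Real.rpow_nonneg (integral_nonneg hh0 : 0 ≤ ∫ x, h x) (1 - 1 / r)
        -- The sign of C is unknown, and `ENNReal.ofReal_mul` needs only its left factor
        -- non-negative.
        rw [mul_comm C, ENNReal.ofReal_mul (by positivity), ENNReal.ofReal_mul (by positivity),
          ENNReal.ofReal_mul i₁]
        ring

end

/-! ### Beckner's constant and the positive definite solutions -/

theorem rpow_one_div_self {s : ℝ} (hs : 0 < s) : s ^ (1 / s) = ((1 / s) ^ (1 / s))⁻¹ := by
  rw [Real.div_rpow zero_le_one hs.le, Real.one_rpow, one_div, one_div, inv_inv]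

theorem becknerConstant_eq_gaussianConstant {p q r : ℝ} (hp : 1 < p) (hq : 1 < q) (hr : 1 < r) :
    becknerConstant p q r = gaussianConstant (1 - 1 / p) (1 - 1 / q) (1 / r) := by
  have conj_pos : ∀ s : ℝ, 1 < s → 0 < s.conjExponent := fun s hs =>
    div_pos (by linarith) (by linarith)
  have conj_inv : ∀ s : ℝ, 1 < s → 1 / s.conjExponent = 1 - 1 / s := fun s hs => by
    have : s ≠ 0 := by linarith
    rw [Real.conjExponent, one_div_div, sub_div, div_self this]
  have hsub : ∀ s : ℝ, 1 < s → 0 < 1 - 1 / s := fun s hs => by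
    rw [sub_pos, div_lt_one (by linarith)]; exact hs
  have p₀ : 0 < p := by linarith
  have q₀ : 0 < q := by linarith
  have r₀ : 0 < r := by linarith
  unfold becknerConstant gaussianConstant
  rw [rpow_one_div_self p₀, rpow_one_div_self q₀, rpow_one_div_self r₀,
    rpow_one_div_self (conj_pos p hp), rpow_one_div_self (conj_pos q hq),
    rpow_one_div_self (conj_pos r hr), conj_inv p hp, conj_inv q hq, conj_inv r hr,
    sub_sub_cancel, sub_sub_cancel]
  have := hsub p hp
  have := hsub q hq
  have := hsub r hr
  congr 1
  field_simp

/-- Here det A = t² a₁a₂a₃ and B_i A B_i^* = t (1 - a_i) a_i. The powers of t cancel because the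
weights 1 - a_i sum to 2. -/
theorem youngDatum_gaussianValue {a₁ a₂ a₃ : ℝ} (h₁ : 0 < a₁) (h₂ : 0 < a₂) (h₃ : 0 < a₃)
    (hs : a₁ + a₂ + a₃ = 1) (c : Fin 3 → ℝ) (hc : ∀ i, 0 < c i) (e₀ : c 0 = 1 - a₁)
    (e₁ : c 1 = 1 - a₂) (e₂ : c 2 = 1 - a₃) {t : ℝ} (ht : 0 < t) :
    (youngDatum c hc).gaussianValue
        !![t * ((1 - a₃) * a₃), -(t * (a₂ * a₃)); -(t * (a₂ * a₃)), t * ((1 - a₂) * a₂)] =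
      gaussianConstant a₁ a₂ a₃ := by
  have c₁ : 0 < 1 - a₁ := by linarith
  have c₂ : 0 < 1 - a₂ := by linarith
  have c₃ : 0 < 1 - a₃ := by linarith
  have hdet : t * ((1 - a₃) * a₃) * (t * ((1 - a₂) * a₂)) -
      -(t * (a₂ * a₃)) * -(t * (a₂ * a₃)) = t ^ 2 * (a₁ * a₂ * a₃) := by
    obtain rfl : a₁ = 1 - a₂ - a₃ := by linarith
    ring
  have hsum : t * ((1 - a₃) * a₃) + t * ((1 - a₂) * a₂) + 2 * -(t * (a₂ * a₃)) =
      t * ((1 - a₁) * a₁) := by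
    obtain rfl : a₁ = 1 - a₂ - a₃ := by linarith
    ring
  have hprod : (t * ((1 - a₁) * a₁)) ^ (1 - a₁) * (t * ((1 - a₂) * a₂)) ^ (1 - a₂) *
      (t * ((1 - a₃) * a₃)) ^ (1 - a₃) * (a₁ ^ a₁ * a₂ ^ a₂ * a₃ ^ a₃) =
      t ^ 2 * (a₁ * a₂ * a₃) *
        ((1 - a₁) ^ (1 - a₁) * (1 - a₂) ^ (1 - a₂) * (1 - a₃) ^ (1 - a₃)) := by
    have split : ∀ a : ℝ, 0 < a → 0 < 1 - a → (t * ((1 - a) * a)) ^ (1 - a) * a ^ a =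
        t ^ (1 - a) * (1 - a) ^ (1 - a) * a := fun a ha hca => by
      have hpow : a ^ (1 - a) * a ^ a = a := by
        rw [← Real.rpow_add ha, sub_add_cancel, Real.rpow_one]
      rw [Real.mul_rpow ht.le (by positivity), Real.mul_rpow hca.le ha.le]
      linear_combination t ^ (1 - a) * (1 - a) ^ (1 - a) * hpow
    have htt : t ^ (1 - a₁) * t ^ (1 - a₂) * t ^ (1 - a₃) = t ^ 2 := by
      rw [← Real.rpow_add ht, ← Real.rpow_add ht,
        show 1 - a₁ + (1 - a₂) + (1 - a₃) = (2 : ℕ) by push_cast; linarith, Real.rpow_natCast]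
    calc _ = ((t * ((1 - a₁) * a₁)) ^ (1 - a₁) * a₁ ^ a₁) *
          ((t * ((1 - a₂) * a₂)) ^ (1 - a₂) * a₂ ^ a₂) *
          ((t * ((1 - a₃) * a₃)) ^ (1 - a₃) * a₃ ^ a₃) := by ring
      _ = _ := by rw [split a₁ h₁ c₁, split a₂ h₂ c₂, split a₃ h₃ c₃, ← htt]; ring
  change √(Matrix.det (_ : Matrix (Fin 2) (Fin 2) ℝ) /
    ∏ i, (youngMap i * (_ : Matrix (Fin 2) (Fin 2) ℝ) * (youngMap i)ᵀ).det ^ c i) = _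
  rw [Matrix.det_fin_two_of, hdet, Fin.prod_univ_three]
  simp only [youngMap_mul_mul_transpose, Matrix.det_fin_one_of, Matrix.cons_val]
  rw [hsum, e₀, e₁, e₂]
  unfold gaussianConstant
  congr 1
  rw [div_eq_div_iff (by positivity) (by positivity), ← hprod]
  ring

theorem youngDatum_posDef_solutions {p q r : ℝ} (hp : 1 < p) (hq : 1 < q) (hr : 1 < r)
    (hpqr : 1 / p + 1 / q = 1 + 1 / r) {c₁ c₂ c₃ : ℝ} (h₁ : c₁ = 1 / p) (h₂ : c₂ = 1 / q)
    (h₃ : c₃ = 1 - 1 / r) (A : Matrix (Fin 2) (Fin 2) ℝ) :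
    A.PosDef ∧
      (youngDatum (youngWeight p q r) (youngWeight_pos hp hq hr)).MatrixCondition A ↔
    ∃ t : ℝ, 0 < t ∧
      A = t • !![c₃ * (1 - c₃), -((1 - c₂) * (1 - c₃));
        -((1 - c₂) * (1 - c₃)), c₂ * (1 - c₂)] := by
  have inv_mem : ∀ s : ℝ, 1 < s → 0 < 1 / s ∧ 1 / s < 1 := fun s hs => by
    refine ⟨by positivity, ?_⟩
    rw [div_lt_one (by linarith)]; exact hs
  obtain ⟨ip, jp⟩ := inv_mem p hp
  obtain ⟨iq, jq⟩ := inv_mem q hq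
  obtain ⟨ir, jr⟩ := inv_mem r hr
  have w₀ : youngWeight p q r 0 = c₁ := h₁.symm
  have w₁ : youngWeight p q r 1 = c₂ := h₂.symm
  have w₂ : youngWeight p q r 2 = c₃ := h₃.symm
  have l₂ : c₂ < 1 := by linarith
  have l₃ : c₃ < 1 := by linarith
  have pos₂ : 0 < c₂ := by linarith
  have pos₃ : 0 < c₃ := by linarith
  have hsum : 1 < c₂ + c₃ := by linarith
  have n₂ : 0 < 1 - c₂ := by linarith
  have n₃ : 0 < 1 - c₃ := by linarith
  constructor
  · rintro ⟨hA, hcond⟩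
    obtain ⟨x, y, z, rfl⟩ : ∃ x y z, A = !![x, z; z, y] := by
      refine ⟨A 0 0, A 1 1, A 0 1, ?_⟩
      have h10 : A 1 0 = A 0 1 := by simpa using hA.1.apply 0 1
      ext i j
      fin_cases i <;> fin_cases j <;> simp [h10]
    obtain ⟨hx, hD⟩ := posDef_fin_two_iff.1 hA
    rw [youngDatum_matrixCondition_iff _ _ _ _ _ hA, w₁, w₂] at hcond
    have hz : z ≠ 0 := by
      rintro rfl
      have : (1 - c₂) * (x * y) = 0 := by linarith [hcond.1]
      have := (mul_eq_zero.1 this).resolve_left n₂.ne'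
      linarith
    rcases (matrixCondition_solutions l₂ l₃ hz).1 ⟨hcond.1, hcond.2.1⟩ with
      ⟨t, rfl, rfl, rfl⟩ | ⟨t, rfl, rfl, rfl⟩
    -- The family (t, t, -t) has determinant 0.
    · nlinarith
    · refine ⟨t, pos_of_mul_pos_left hx (by positivity), ?_⟩
      ext i j
      fin_cases i <;> fin_cases j <;> simp
  · rintro ⟨t, ht, rfl⟩
    have e : t • !![c₃ * (1 - c₃), -((1 - c₂) * (1 - c₃));
        -((1 - c₂) * (1 - c₃)), c₂ * (1 - c₂)] =
        !![t * (c₃ * (1 - c₃)), -(t * ((1 - c₂) * (1 - c₃)));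
        -(t * ((1 - c₂) * (1 - c₃))), t * (c₂ * (1 - c₂))] := by
      ext i j
      fin_cases i <;> fin_cases j <;> simp
    have hA : !![t * (c₃ * (1 - c₃)), -(t * ((1 - c₂) * (1 - c₃)));
        -(t * ((1 - c₂) * (1 - c₃))), t * (c₂ * (1 - c₂))].PosDef := by
      refine posDef_fin_two_iff.2 ⟨by positivity, ?_⟩
      -- This is the determinant in factored form; c₂ + c₃ - 1 = 1 - c₁ > 0.
      have : 0 < t ^ 2 * ((1 - c₂) * (1 - c₃) * (c₂ + c₃ - 1)) :=
        mul_pos (by positivity) (mul_pos (mul_pos n₂ n₃) (by linarith))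
      linarith
    rw [e]
    refine ⟨hA, (youngDatum_matrixCondition_iff _ _ _ _ _ hA).2 ?_⟩
    rw [w₀, w₁, w₂]
    exact ⟨by ring, by ring, by linarith⟩

theorem mainTheorem5 {𝕜 : Type*} [RCLike 𝕜] (p q r : ℝ) (hp : 1 < p) (hq : 1 < q) (hr : 1 < r)
    (hpqr : 1 / p + 1 / q = 1 + 1 / r)
    (c₁ c₂ c₃ : ℝ) (h₁ : c₁ = 1 / p) (h₂ : c₂ = 1 / q) (h₃ : c₃ = 1 - 1 / r) :
    -- the convolution of `F ∈ L_p` and `G ∈ L_q` is well defined and belongs to `L_r`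
    (∀ F G : ℝ → 𝕜, MemLp F (ENNReal.ofReal p) volume → MemLp G (ENNReal.ofReal q) volume →
      (∀ᵐ x : ℝ, ConvolutionExistsAt F G x (ContinuousLinearMap.mul 𝕜 𝕜) volume) ∧
      MemLp (lineConvolution F G) (ENNReal.ofReal r) volume) ∧
    -- the best constant in Young's inequality, which is smaller than `1`
    IsLeast {C : ℝ | YoungInequality 𝕜 p q r C} (becknerConstant p q r) ∧
    becknerConstant p q r < 1 ∧
    -- it is the best constant in the dual trilinear inequality
    IsLeast {C : ℝ | TrilinearInequality c₁ c₂ c₃ C} (becknerConstant p q r) ∧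
    -- that is, the Brascamp-Lieb constant of the associated datum
    (youngDatum (youngWeight p q r) (youngWeight_pos hp hq hr)).IsConstant
      (becknerConstant p q r) ∧
    -- the condition on a positive definite `A`, in coordinates
    (∀ (c : Fin 3 → ℝ) (hc : ∀ i, 0 < c i) (x y z : ℝ), !![x, z; z, y].PosDef →
      ((youngDatum c hc).MatrixCondition !![x, z; z, y] ↔
        (1 - c 1) * (x * y) + y * z + c 1 * z ^ 2 = 0 ∧
        (1 - c 2) * (x * y) + x * z + c 2 * z ^ 2 = 0 ∧
        c 0 + c 1 + c 2 = 2)) ∧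
    -- the two families of solutions of the first two equations
    (∀ x y z : ℝ, z ≠ 0 →
      ((1 - c₂) * (x * y) + y * z + c₂ * z ^ 2 = 0 ∧
        (1 - c₃) * (x * y) + x * z + c₃ * z ^ 2 = 0 ↔
        (∃ t : ℝ, x = t ∧ y = t ∧ z = -t) ∨
        (∃ t : ℝ, x = t * (c₃ * (1 - c₃)) ∧ y = t * (c₂ * (1 - c₂)) ∧
          z = -(t * ((1 - c₂) * (1 - c₃)))))) ∧
    -- the positive definite solutions
    (∀ A : Matrix (Fin 2) (Fin 2) ℝ,
      A.PosDef ∧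
        (youngDatum (youngWeight p q r) (youngWeight_pos hp hq hr)).MatrixCondition A ↔
      ∃ t : ℝ, 0 < t ∧
        A = t • !![c₃ * (1 - c₃), -((1 - c₂) * (1 - c₃));
          -((1 - c₂) * (1 - c₃)), c₂ * (1 - c₂)]) ∧
    -- the value of the constant in terms of `A`, and in terms of the weights
    (∀ A : Matrix (Fin 2) (Fin 2) ℝ, A.PosDef →
      (youngDatum (youngWeight p q r) (youngWeight_pos hp hq hr)).MatrixCondition A →
      becknerConstant p q r =
        (youngDatum (youngWeight p q r) (youngWeight_pos hp hq hr)).gaussianValue A) ∧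
    becknerConstant p q r =
      √(((1 - c₁) ^ (1 - c₁) * (1 - c₂) ^ (1 - c₂) * (1 - c₃) ^ (1 - c₃)) /
        (c₁ ^ c₁ * c₂ ^ c₂ * c₃ ^ c₃)) := by
  have inv_mem : ∀ s : ℝ, 1 < s → 0 < 1 / s ∧ 0 < 1 - 1 / s := fun s hs => by
    refine ⟨by positivity, ?_⟩
    rw [sub_pos, div_lt_one (by linarith)]; exact hs
  have p₀ : 0 < p := by linarith
  have q₀ : 0 < q := by linarith
  obtain ⟨ip, jp⟩ := inv_mem p hp
  obtain ⟨iq, jq⟩ := inv_mem q hq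
  obtain ⟨ir, jr⟩ := inv_mem r hr
  have hs : (1 - 1 / p) + (1 - 1 / q) + 1 / r = 1 := by linarith
  have hK := becknerConstant_eq_gaussianConstant hp hq hr
  have hK0 : 0 ≤ becknerConstant p q r := Real.sqrt_nonneg _
  have tri : TrilinearInequality (1 / p) (1 / q) (1 - 1 / r) (becknerConstant p q r) := by
    have := trilinearInequality_gaussianConstant jp jq ir hs
    rwa [sub_sub_cancel, sub_sub_cancel, ← hK] at this
  have low : ∀ C, TrilinearInequality (1 / p) (1 / q) (1 - 1 / r) C →
      becknerConstant p q r ≤ C := by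
    intro C hC
    rw [hK]
    refine gaussianConstant_le_of_trilinearInequality jp jq ir hs ?_
    rwa [sub_sub_cancel, sub_sub_cancel]
  refine ⟨fun F G hF hG => ⟨ae_convolutionExistsAt p₀ q₀ hr hK0 tri hF hG,
      memLp_lineConvolution p₀ q₀ hr hK0 tri hF hG⟩,
    ⟨youngInequality_of_trilinearInequality p₀ q₀ hr hK0 tri, fun C hC =>
      low C (trilinearInequality_of_youngInequality p₀ q₀ hr hK0 tri hC)⟩, ?_, ?_, ?_,
    youngDatum_matrixCondition_iff, ?_,
    youngDatum_posDef_solutions hp hq hr hpqr h₁ h₂ h₃, ?_, ?_⟩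
  · rw [hK]
    exact gaussianConstant_lt_one jp jq ir hs
  · rw [h₁, h₂, h₃]
    exact ⟨tri, low⟩
  · have iff : ∀ C, (youngDatum (youngWeight p q r) (youngWeight_pos hp hq hr)).Inequality C ↔
        TrilinearInequality (1 / p) (1 / q) (1 - 1 / r) C := by
      intro C
      rw [youngDatum_inequality_iff, show youngWeight p q r 0 = 1 / p from rfl,
        show youngWeight p q r 1 = 1 / q from rfl, show youngWeight p q r 2 = 1 - 1 / r from rfl]
    exact ⟨(iff _).2 tri, fun C hC => low C ((iff C).1 hC)⟩
  · intro x y z hz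
    exact matrixCondition_solutions (by linarith) (by linarith) hz
  · intro A hA hcond
    obtain ⟨t, ht, hAt⟩ :=
      (youngDatum_posDef_solutions hp hq hr hpqr h₁ h₂ h₃ A).1 ⟨hA, hcond⟩
    have e : A = !![t * ((1 - 1 / r) * (1 / r)), -(t * ((1 - 1 / q) * (1 / r)));
        -(t * ((1 - 1 / q) * (1 / r))), t * ((1 - (1 - 1 / q)) * (1 - 1 / q))] := by
      rw [hAt, h₂, h₃, sub_sub_cancel, sub_sub_cancel]
      ext i j
      fin_cases i <;> fin_cases j <;> simp only [Matrix.smul_apply, smul_eq_mul] <;> simp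
    rw [hK, e]
    exact (youngDatum_gaussianValue jp jq ir hs (youngWeight p q r) (youngWeight_pos hp hq hr)
      (sub_sub_cancel _ _).symm (sub_sub_cancel _ _).symm rfl ht).symm
  · rw [hK, gaussianConstant, h₁, h₂, h₃]
    simp only [sub_sub_cancel]
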